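/- Let $n\ge 1$, $s>\frac n2$, $\omega>0$, and write $\hat u(\xi)=\int_{\mathbf R^n}u(x)e^{-2\pi i x\cdot\xi}\,dx$, so that $(-\Delta)^s$ is multiplication by $(2\pi|\xi|)^{2s}$ on the Fourier side. For $\lambda>0$ let $\mathcal G_s^\lambda\in H^s(\mathbf R^n)\subset C(\mathbf R^n)$ be given by $\widehat{\mathcal G_s^\lambda}(\xi)=\frac{1}{(2\pi|\xi|)^{2s}+\lambda}$. Let $$c^2(\omega)=\inf_{0\ne u\in\mathcal S(\mathbf R^n)}\frac{\|(-\Delta)^{s/2}u\|_{L^2}^2+\omega\|u\|_{L^2}^2}{\|u\|_{L^\infty}^2}.$$ For $\mu>0$ let $L_\mu=(-\Delta)^s+\omega-\mu\delta_0$ be the operator in $L^2(\mathbf R^n)$ (complex-valued functions) with domain $D(L_\mu)=\{\psi\in H^s:\ \psi=g+\mu\,\psi(0)\,\mathcal G_s^\omega,\ g\in H^{2s}\}$ and action $L_\mu\psi=((-\Delta)^s+\omega)g$. Then $L_\mu$ is self-adjoint, and: (i) If $\mu>c^2(\omega)$, then $L_\mu$ has exactly one negative eigenvalue $-\lambda$,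 $\lambda>0$; it is simple, with eigenfunction $\Psi_0=\mathcal G_s^{\omega+\lambda}$, that is, $\widehat{\Psi_0}(\xi)=\frac1{(2\pi|\xi|)^{2s}+\omega+\lambda}$. Moreover $\sigma(L_\mu)\setminus\{-\lambda\}\subset[\omega,\infty)$ and $L_\mu|_{\{\Psi_0\}^\perp}\ge\omega$. (ii) If $\mu=c^2(\omega)$, then $L_\mu\ge0$, $0$ is a simple eigenvalue with eigenfunction $\Psi_0=\mathcal G_s^\omega$, $\sigma(L_\mu)\setminus\{0\}\subset[\omega,\infty)$ and $L_\mu|_{\{\Psi_0\}^\perp}\ge\omega$. (iii) If $0<\mu<c^2(\omega)$, then $L_\mu$ has a simple eigenvalue $\lambda\in(0,\omega)$ with eigenfunction $\Psi_0=\mathcal G_s^{\omega-\lambda}$, that is, $\widehat{\Psi_0}(\xi)=\frac1{(2\pi|\xi|)^{2s}+\omega-\lambda}$. Moreover $\sigma(L_\mu)\setminus\{\lambda\}\subset[\omega,\infty)$ and $L_\mu|_{\{\Psi_0\}^\perp}\ge\omega$ (in particular $\ge\lambda>0$). Consequently, let $\sigma>0$, let $\phi_\omega$ be the standing wave profile $$\hat\phi_\omega(\xi)=\Big(\int_{\mathbf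 R^n}\frac{d\eta}{(2\pi|\eta|)^{2s}+\omega}\Big)^{-(1+\frac1{2\sigma})}\frac1{(2\pi|\xi|)^{2s}+\omega},$$ and let $\mathcal L_-=(-\Delta)^s+\omega-|\phi_\omega(0)|^{2\sigma}\delta_0$ and $\mathcal L_+=(-\Delta)^s+\omega-(2\sigma+1)|\phi_\omega(0)|^{2\sigma}\delta_0$, defined as the operators $L_\mu$ with these values of $\mu$. Then both operators are self-adjoint, and: (iv) $\mathcal L_-\ge0$, $0$ is a simple eigenvalue with $\mathrm{Ker}(\mathcal L_-)=\mathrm{span}\{\mathcal G_s^\omega\}$, $\sigma(\mathcal L_-)\setminus\{0\}\subset[\omega,\infty)$ and $\mathcal L_-|_{\{\mathcal G_s^\omega\}^\perp}\ge\omega$. (v) $\mathcal L_+$ has exactly one negative eigenvalue $-\lambda$, $\lambda>0$; it is simple, with eigenfunction $\Psi_0=\mathcal G_s^{\omega+\lambda}$; moreover $\mathrm{Ker}(\mathcal L_+)=\{0\}$, $\sigma(\mathcal L_+)\setminus\{-\lambda\}\subset[\omega,\infty)$ and $\mathcal L_+|_{\{\Psi_0\}^\perp}\ge\omega$. -/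

import Mathlib

open MeasureTheory FourierTransform TemperedDistribution
open scoped SchwartzMap ENNReal

namespace DeltaSchrodinger

/-- Euclidean space `ℝⁿ`. -/
abbrev Space (n : ℕ) : Type := EuclideanSpace ℝ (Fin n)

/-- The complex Hilbert space `L²(ℝⁿ)`. -/
abbrev L2 (n : ℕ) : Type := Lp ℂ 2 (volume : Measure (Space n))

noncomputable section

/-! ### Fractional Laplacian -/

/-- The symbol `(2π|ξ|)^{2s}` of `(-Δ)^s` for the convention `û(ξ) = ∫ u(x) e^{-2πi x·ξ} dx`. -/
def symbol {n : ℕ} (s : ℝ) (ξ : Space n) : ℝ := (2 * Real.pi * ‖ξ‖) ^ (2 * s)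

theorem symbol_nonneg {n : ℕ} (s : ℝ) (ξ : Space n) : 0 ≤ symbol s ξ := by
  unfold symbol; positivity

theorem measurable_symbol {n : ℕ} (s : ℝ) : Measurable (symbol (n := n) s) := by
  unfold symbol; fun_prop

/-- The maximal domain `{f ∈ L² : m f ∈ L²}` of multiplication by `m`. -/
def mulDomain {n : ℕ} (m : Space n → ℝ) : Submodule ℂ (L2 n) where
  carrier := {f | MemLp (fun ξ => (m ξ : ℂ) * f ξ) 2 volume}
  zero_mem' := by
    refine MemLp.ae_eq ?_ (MemLp.zero (ε := ℂ) (p := 2) (μ := (volume : Measure (Space n))))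
    filter_upwards [Lp.coeFn_zero ℂ 2 (volume : Measure (Space n))] with ξ h
    rw [h]; simp
  add_mem' := by
    intro f g hf hg
    refine MemLp.ae_eq ?_ (MemLp.add hf hg)
    filter_upwards [Lp.coeFn_add f g] with ξ h
    rw [h]; simp [mul_add]
  smul_mem' := by
    intro c f hf
    refine MemLp.ae_eq ?_ (MemLp.const_smul hf c)
    filter_upwards [Lp.coeFn_smul c f] with ξ h
    rw [h]; simp; ring

/-- Multiplication by a real function `m` as an unbounded operator in `L²(ℝⁿ)`, on its maximal
domain. -/
def mulOp {n : ℕ} (m : Space n → ℝ) : L2 n →ₗ.[ℂ] L2 n where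
  domain := mulDomain m
  toFun :=
    { toFun := fun f => MemLp.toLp (fun ξ => (m ξ : ℂ) * (f : L2 n) ξ) f.2
      map_add' := by
        rintro ⟨f, hf⟩ ⟨g, hg⟩
        refine Lp.ext ?_
        filter_upwards [MemLp.coeFn_toLp ((mulDomain m).add_mem hf hg),
          Lp.coeFn_add (MemLp.toLp _ hf) (MemLp.toLp _ hg), MemLp.coeFn_toLp hf,
          MemLp.coeFn_toLp hg, Lp.coeFn_add f g] with ξ h1 h2 h3 h4 h5
        refine h1.trans (Eq.trans ?_ h2.symm)
        rw [Pi.add_apply, h3, h4, h5, Pi.add_apply, mul_add]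
      map_smul' := by
        rintro c ⟨f, hf⟩
        refine Lp.ext ?_
        filter_upwards [MemLp.coeFn_toLp ((mulDomain m).smul_mem c hf),
          Lp.coeFn_smul c (MemLp.toLp _ hf), MemLp.coeFn_toLp hf,
          Lp.coeFn_smul c f] with ξ h1 h2 h3 h4
        refine h1.trans (Eq.trans ?_ h2.symm)
        rw [Pi.smul_apply, h3, h4, Pi.smul_apply, smul_eq_mul, smul_eq_mul, mul_left_comm] }

/-- `(-Δ)^s` as an unbounded operator in `L²(ℝⁿ)`: `(-Δ)^s f = 𝓕⁻¹ ((2π|ξ|)^{2s} 𝓕 f)`, on the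
maximal domain. For `s ≥ 0` the domain is `H^{2s}(ℝⁿ)`, see `mem_fracLaplacian_domain_iff`. -/
def fracLaplacian (n : ℕ) (s : ℝ) : L2 n →ₗ.[ℂ] L2 n where
  domain := (mulOp (symbol (n := n) s)).domain.comap
    (Lp.fourierTransformₗᵢ (Space n) ℂ).toLinearEquiv.toLinearMap
  toFun := (Lp.fourierTransformₗᵢ (Space n) ℂ).symm.toLinearEquiv.toLinearMap ∘ₗ
    (mulOp (symbol (n := n) s)).toFun ∘ₗ
      (Lp.fourierTransformₗᵢ (Space n) ℂ).toLinearEquiv.toLinearMap.submoduleComap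
        (mulOp (symbol (n := n) s)).domain

theorem mem_fracLaplacian_domain {n : ℕ} {s : ℝ} {f : L2 n} :
    f ∈ (fracLaplacian n s).domain ↔
      MemLp (fun ξ => (symbol s ξ : ℂ) * (𝓕 f : L2 n) ξ) 2 volume := Iff.rfl

theorem fourier_fracLaplacian {n : ℕ} {s : ℝ} (f : (fracLaplacian n s).domain) :
    (𝓕 (fracLaplacian n s f) : L2 n) =ᵐ[volume]
      fun ξ => (symbol s ξ : ℂ) * (𝓕 (f : L2 n) : L2 n) ξ := by
  have : (𝓕 (fracLaplacian n s f) : L2 n) =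
      MemLp.toLp _ (mem_fracLaplacian_domain.1 f.2) :=
    (Lp.fourierTransformₗᵢ (Space n) ℂ).apply_symm_apply _
  rw [this]
  exact MemLp.coeFn_toLp _

theorem one_add_norm_sq_rpow_le {n : ℕ} {s : ℝ} (hs : 0 ≤ s) (ξ : Space n) :
    ((1 + ‖ξ‖ ^ 2) ^ s : ℝ) ≤ 2 ^ s * (1 + symbol s ξ) := by
  have hpi : (1 : ℝ) ≤ 2 * Real.pi := by linarith [Real.pi_gt_three]
  have hsn := symbol_nonneg s ξ
  rcases le_total ‖ξ‖ 1 with h1 | h1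
  · calc ((1 + ‖ξ‖ ^ 2) ^ s : ℝ) ≤ 2 ^ s := by
          apply Real.rpow_le_rpow (by positivity) _ hs
          nlinarith [norm_nonneg ξ]
      _ ≤ 2 ^ s * (1 + symbol s ξ) := le_mul_of_one_le_right (by positivity) (by linarith)
  · calc ((1 + ‖ξ‖ ^ 2) ^ s : ℝ) ≤ (2 * (2 * Real.pi * ‖ξ‖) ^ (2 : ℝ)) ^ s := by
          apply Real.rpow_le_rpow (by positivity) _ hs
          rw [Real.rpow_two]
          have : ‖ξ‖ ≤ 2 * Real.pi * ‖ξ‖ := le_mul_of_one_le_left (norm_nonneg _) hpi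
          nlinarith [norm_nonneg ξ]
      _ = 2 ^ s * symbol s ξ := by
          rw [Real.mul_rpow (by norm_num) (by positivity), ← Real.rpow_mul (by positivity)]
          rfl
      _ ≤ 2 ^ s * (1 + symbol s ξ) := by gcongr; linarith

/-- Membership in the Bessel potential space `H^r(ℝⁿ)` in terms of the Fourier transform. -/
theorem memSobolev_iff_memLp {n : ℕ} (r : ℝ) (f : L2 n) :
    MemSobolev r 2 (f : 𝓢'(Space n, ℂ)) ↔
      MemLp (fun ξ => (((1 + ‖ξ‖ ^ 2) ^ (r / 2) : ℝ) : ℂ) * (𝓕 f : L2 n) ξ) 2 volume := by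
  rw [memSobolev_iff_exists_smulLeftCLM_fourier, Lp.fourier_toTemperedDistribution_eq]
  have hg : ∀ t : ℝ, (fun x : Space n => (((1 + ‖x‖ ^ 2) ^ t : ℝ) : ℂ)).HasTemperateGrowth := by
    intro t; fun_prop
  set h : L2 n := 𝓕 f
  have hinv : ∀ ξ : Space n, (((1 + ‖ξ‖ ^ 2) ^ (-(r / 2)) : ℝ) : ℂ) *
      (((1 + ‖ξ‖ ^ 2) ^ (r / 2) : ℝ) : ℂ) = 1 := by
    intro ξ
    have h0 : (0 : ℝ) < 1 + ‖ξ‖ ^ 2 := by positivity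
    rw [← Complex.ofReal_mul, ← Real.rpow_add h0]; simp
  have hclm : ∀ (t : ℝ) (k l : L2 n),
      smulLeftCLM ℂ (fun x : Space n => (((1 + ‖x‖ ^ 2) ^ t : ℝ) : ℂ)) (k : 𝓢'(Space n, ℂ)) =
        (l : 𝓢'(Space n, ℂ)) →
      (l : Space n → ℂ) =ᵐ[volume] fun ξ => (((1 + ‖ξ‖ ^ 2) ^ t : ℝ) : ℂ) * k ξ := by
    intro t k l hkl
    have hloc : LocallyIntegrable (fun ξ => (((1 + ‖ξ‖ ^ 2) ^ t : ℝ) : ℂ) * k ξ) volume := by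
      have h1 := (Lp.memLp k).locallyIntegrable (by norm_num)
      rw [← locallyIntegrableOn_univ] at h1 ⊢
      exact h1.continuousOn_mul (hg t).1.continuous.continuousOn isOpen_univ.isLocallyClosed
    have hl := (Lp.memLp l).locallyIntegrable (by norm_num)
    have hz := ae_eq_zero_of_integral_contDiff_smul_eq_zero (hl.sub hloc) (fun g g_smooth g_cpt => by
      have hg₁ : HasCompactSupport (Complex.ofRealCLM ∘ g) := g_cpt.comp_left rfl
      have hg₂ : ContDiff ℝ ((⊤ : ℕ∞) : WithTop ℕ∞) (Complex.ofRealCLM ∘ g) := by fun_prop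
      have e := DFunLike.congr_fun hkl (hg₁.toSchwartzMap hg₂)
      have i1 : Integrable (fun x => g x • l x) volume :=
        hl.integrable_smul_left_of_hasCompactSupport g_smooth.continuous g_cpt
      have i2 : Integrable (fun x => g x • ((((1 + ‖x‖ ^ 2) ^ t : ℝ) : ℂ) * k x)) volume :=
        hloc.integrable_smul_left_of_hasCompactSupport g_smooth.continuous g_cpt
      simp only [Lp.toTemperedDistribution_apply, smulLeftCLM_apply_apply] at e
      simp only [Pi.sub_apply, smul_sub]
      rw [integral_sub i1 i2, sub_eq_zero]
      refine Eq.trans ?_ (e.symm.trans ?_)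
      · simp
      · apply integral_congr_ae
        filter_upwards with x
        rw [SchwartzMap.smulLeftCLM_apply_apply (hg t)]
        simp; ring)
    filter_upwards [hz] with x hx
    exact sub_eq_zero.1 hx
  constructor
  · rintro ⟨f', hf'⟩
    exact (Lp.memLp f').ae_eq (hclm _ _ _ hf')
  · intro hm
    refine ⟨hm.toLp _, ?_⟩
    ext u
    simp only [Lp.toTemperedDistribution_apply, smulLeftCLM_apply_apply]
    apply integral_congr_ae
    filter_upwards [hm.coeFn_toLp] with x hx
    rw [hx, SchwartzMap.smulLeftCLM_apply_apply (hg _)]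
    simp; ring

/-- For `s ≥ 0` the domain of `(-Δ)^s` is the Sobolev space `H^{2s}(ℝⁿ)`. -/
theorem mem_fracLaplacian_domain_iff {n : ℕ} {s : ℝ} (hs : 0 ≤ s) (f : L2 n) :
    f ∈ (fracLaplacian n s).domain ↔ MemSobolev (2 * s) 2 (f : 𝓢'(Space n, ℂ)) := by
  rw [memSobolev_iff_memLp, mem_fracLaplacian_domain]
  set h : L2 n := 𝓕 f
  have hh := Lp.memLp h
  have hpi : (1 : ℝ) ≤ 2 * Real.pi := by linarith [Real.pi_gt_three]
  have he : 2 * s / 2 = s := by ring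
  have hw := one_add_norm_sq_rpow_le (n := n) hs
  have hw' : ∀ ξ : Space n, symbol s ξ ≤ (2 * Real.pi) ^ (2 * s) * (1 + ‖ξ‖ ^ 2) ^ s := by
    intro ξ
    rw [symbol, Real.mul_rpow (by positivity) (norm_nonneg _), Real.rpow_mul (norm_nonneg ξ),
      Real.rpow_two]
    gcongr
    linarith
  rw [he]
  constructor
  · intro hm
    have hsum := (hh.norm.add hm.norm).const_mul (2 ^ s : ℝ)
    refine hsum.mono ?_ ?_
    · exact (Measurable.aestronglyMeasurable (by fun_prop)).mul hh.1
    · filter_upwards with ξ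
      have hsn := symbol_nonneg s ξ
      simp only [norm_mul, Complex.norm_real, Real.norm_eq_abs, Pi.add_apply]
      rw [abs_of_nonneg (by positivity : (0 : ℝ) ≤ (1 + ‖ξ‖ ^ 2) ^ s), abs_of_nonneg hsn,
        abs_of_nonneg (by positivity : (0 : ℝ) ≤ (2 : ℝ) ^ s),
        abs_of_nonneg (by positivity : (0 : ℝ) ≤ ‖h ξ‖ + symbol s ξ * ‖h ξ‖)]
      nlinarith [hw ξ, norm_nonneg (h ξ), mul_le_mul_of_nonneg_right (hw ξ) (norm_nonneg (h ξ))]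
  · intro hm
    refine (hm.norm.const_mul ((2 * Real.pi) ^ (2 * s))).mono ?_ ?_
    · exact (Complex.measurable_ofReal.comp (measurable_symbol s)).aestronglyMeasurable.mul hh.1
    · filter_upwards with ξ
      have hsn := symbol_nonneg s ξ
      have hp : (0 : ℝ) ≤ (1 + ‖ξ‖ ^ 2) ^ s := by positivity
      rw [norm_mul, norm_mul, norm_norm, norm_mul, Complex.norm_of_nonneg hsn,
        Complex.norm_of_nonneg hp, Real.norm_of_nonneg (by positivity)]
      nlinarith [mul_le_mul_of_nonneg_right (hw' ξ) (norm_nonneg (h ξ))]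

/-! ### Point values and the Green function -/

/-- `ψ` has a continuous representative. -/
def HasContinuousRep {n : ℕ} (ψ : L2 n) : Prop :=
  ∃ u : Space n → ℂ, Continuous u ∧ ψ =ᵐ[volume] u

open Classical in
/-- The value `ψ(0)` of the continuous representative of `ψ`. -/
def valueAtZero {n : ℕ} (ψ : L2 n) : ℂ :=
  if h : HasContinuousRep ψ then h.choose 0 else 0

theorem valueAtZero_eq {n : ℕ} {ψ : L2 n} {u : Space n → ℂ} (hu : Continuous u)
    (h : ψ =ᵐ[volume] u) : valueAtZero ψ = u 0 := by
  have hex : HasContinuousRep ψ := ⟨u, hu, h⟩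
  rw [valueAtZero, dif_pos hex]
  have := (Continuous.ae_eq_iff_eq volume hex.choose_spec.1 hu).1
    (hex.choose_spec.2.symm.trans h)
  rw [this]

theorem HasContinuousRep.add {n : ℕ} {ψ χ : L2 n} (hψ : HasContinuousRep ψ)
    (hχ : HasContinuousRep χ) :
    HasContinuousRep (ψ + χ) ∧ valueAtZero (ψ + χ) = valueAtZero ψ + valueAtZero χ := by
  obtain ⟨u, hu, hu'⟩ := hψ
  obtain ⟨v, hv, hv'⟩ := hχ
  have h : (ψ + χ : L2 n) =ᵐ[volume] u + v := (Lp.coeFn_add ψ χ).trans (hu'.add hv')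
  refine ⟨⟨_, hu.add hv, h⟩, ?_⟩
  rw [valueAtZero_eq (hu.add hv) h, valueAtZero_eq hu hu', valueAtZero_eq hv hv']
  rfl

theorem HasContinuousRep.smul {n : ℕ} {ψ : L2 n} (c : ℂ) (hψ : HasContinuousRep ψ) :
    HasContinuousRep (c • ψ) ∧ valueAtZero (c • ψ) = c * valueAtZero ψ := by
  obtain ⟨u, hu, hu'⟩ := hψ
  have h : (c • ψ : L2 n) =ᵐ[volume] c • u := (Lp.coeFn_smul c ψ).trans (hu'.const_smul c)
  refine ⟨⟨_, hu.const_smul c, h⟩, ?_⟩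
  rw [valueAtZero_eq (hu.const_smul c) h, valueAtZero_eq hu hu']
  rfl

theorem hasContinuousRep_zero {n : ℕ} :
    HasContinuousRep (0 : L2 n) ∧ valueAtZero (0 : L2 n) = 0 := by
  have h : (0 : L2 n) =ᵐ[volume] (0 : Space n → ℂ) := Lp.coeFn_zero _ _ _
  exact ⟨⟨0, continuous_zero, h⟩, valueAtZero_eq continuous_zero h⟩

/-- The function `1 / ((2π|ξ|)^{2s} + lam)`. -/
def greenSymbol {n : ℕ} (s lam : ℝ) (ξ : Space n) : ℝ := 1 / (symbol s ξ + lam)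

theorem memLp_greenSymbol {n : ℕ} {s lam : ℝ} (hs : (n : ℝ) / 2 < s) (hlam : 0 < lam) :
    MemLp (fun ξ : Space n => (greenSymbol s lam ξ : ℂ)) 2 volume := by
  have hs0 : 0 < s := lt_of_le_of_lt (by positivity) hs
  have hmeas : Measurable (fun ξ : Space n => greenSymbol s lam ξ) := by
    unfold greenSymbol
    exact measurable_const.div ((measurable_symbol s).add_const lam)
  suffices hreal : MemLp (fun ξ : Space n => greenSymbol s lam ξ) 2 volume from hreal.ofReal
  rw [memLp_two_iff_integrable_sq hmeas.aestronglyMeasurable]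
  have hfin : (Module.finrank ℝ (Space n) : ℝ) < 4 * s := by
    rw [finrank_euclideanSpace_fin]; linarith
  have hI := (integrable_rpow_neg_one_add_norm_sq (E := Space n) (μ := volume) hfin).const_mul
    ((2 ^ s * (1 + 1 / lam)) ^ 2)
  refine hI.mono' (hmeas.pow_const 2).aestronglyMeasurable ?_
  filter_upwards with ξ
  have hsn := symbol_nonneg s ξ
  have hw := one_add_norm_sq_rpow_le hs0.le ξ
  have hp : (0 : ℝ) < (1 + ‖ξ‖ ^ 2) ^ s := by positivity
  have hle : greenSymbol s lam ξ ≤ 2 ^ s * (1 + 1 / lam) * (1 + ‖ξ‖ ^ 2) ^ (-s) := by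
    rw [greenSymbol, Real.rpow_neg (by positivity), ← div_eq_mul_inv,
      div_le_div_iff₀ (by positivity) hp, one_mul]
    refine hw.trans ?_
    rw [mul_assoc]
    gcongr
    have : (1 + 1 / lam) * (symbol s ξ + lam) = symbol s ξ + lam + symbol s ξ / lam + 1 := by
      field_simp; ring
    rw [this]
    have : 0 ≤ symbol s ξ / lam := by positivity
    linarith
  have hg0 : 0 ≤ greenSymbol s lam ξ := by unfold greenSymbol; positivity
  rw [Real.norm_of_nonneg (by positivity)]
  calc greenSymbol s lam ξ ^ 2 ≤ (2 ^ s * (1 + 1 / lam) * (1 + ‖ξ‖ ^ 2) ^ (-s)) ^ 2 := by gcongr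
    _ = (2 ^ s * (1 + 1 / lam)) ^ 2 * (1 + ‖ξ‖ ^ 2) ^ (-(4 * s) / 2) := by
      rw [mul_pow, ← Real.rpow_natCast ((1 + ‖ξ‖ ^ 2) ^ (-s)) 2, ← Real.rpow_mul (by positivity)]
      congr 2
      push_cast; ring

open Classical in
/-- The Green function `G_s^lam` of `(-Δ)^s + lam`: the element of `L²(ℝⁿ)` whose Fourier transform
is `1 / ((2π|ξ|)^{2s} + lam)`. This function is in `L²` for `s > n/2`, `lam > 0`, by
`memLp_greenSymbol`. -/
def green (n : ℕ) (s lam : ℝ) : L2 n :=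
  if h : MemLp (fun ξ : Space n => (greenSymbol s lam ξ : ℂ)) 2 volume then 𝓕⁻ (h.toLp _ : L2 n)
  else 0

theorem fourier_green {n : ℕ} {s lam : ℝ} (hs : (n : ℝ) / 2 < s) (hlam : 0 < lam) :
    (𝓕 (green n s lam) : L2 n) =ᵐ[volume] fun ξ => (greenSymbol s lam ξ : ℂ) := by
  rw [green, dif_pos (memLp_greenSymbol hs hlam), FourierTransform.fourier_fourierInv_eq]
  exact MemLp.coeFn_toLp _

/-! ### The operators `(-Δ)^s + ω - μ δ₀` -/

/-- The operator `L_μ = (-Δ)^s + ω - μ δ₀` in `L²(ℝⁿ)`, for `s > n/2`. Its domain consists of the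
`ψ ∈ H^s(ℝⁿ) ⊂ C(ℝⁿ)` of the form `ψ = g + μ ψ(0) G_s^ω` with `g ∈ H^{2s}(ℝⁿ)`, and
`L_μ ψ = ((-Δ)^s + ω) g`. -/
def deltaOp (n : ℕ) (s ω μ : ℝ) : L2 n →ₗ.[ℂ] L2 n where
  domain :=
    { carrier := {ψ | MemSobolev s 2 (ψ : 𝓢'(Space n, ℂ)) ∧ HasContinuousRep ψ ∧
        ψ - (μ * valueAtZero ψ) • green n s ω ∈ (fracLaplacian n s).domain}
      zero_mem' := by
        refine ⟨?_, hasContinuousRep_zero.1, ?_⟩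
        · rw [← Lp.toTemperedDistributionCLM_apply, map_zero]
          exact memSobolev_fun_zero _ _ _ _
        · rw [hasContinuousRep_zero.2]; simp
      add_mem' := by
        rintro ψ χ ⟨h1, h2, h3⟩ ⟨k1, k2, k3⟩
        refine ⟨?_, (h2.add k2).1, ?_⟩
        · rw [← Lp.toTemperedDistributionCLM_apply, map_add]
          exact h1.add k1
        · rw [(h2.add k2).2]
          convert Submodule.add_mem _ h3 k3 using 1
          module
      smul_mem' := by
        rintro c ψ ⟨h1, h2, h3⟩
        refine ⟨?_, (h2.smul c).1, ?_⟩
        · rw [← Lp.toTemperedDistributionCLM_apply, map_smul]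
          exact h1.smul c
        · rw [(h2.smul c).2]
          convert Submodule.smul_mem _ c h3 using 1
          module }
  toFun :=
    { toFun := fun ψ =>
        fracLaplacian n s ⟨(ψ : L2 n) - (μ * valueAtZero (ψ : L2 n)) • green n s ω, ψ.2.2.2⟩ +
          (ω : ℂ) • ((ψ : L2 n) - (μ * valueAtZero (ψ : L2 n)) • green n s ω)
      map_add' := by
        rintro ⟨ψ, hψ⟩ ⟨χ, hχ⟩
        have hg : (ψ + χ) - (μ * valueAtZero (ψ + χ)) • green n s ω =
            (ψ - (μ * valueAtZero ψ) • green n s ω) + (χ - (μ * valueAtZero χ) • green n s ω) := by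
          rw [(hψ.2.1.add hχ.2.1).2]; module
        have hF := (fracLaplacian n s).map_add ⟨_, hψ.2.2⟩ ⟨_, hχ.2.2⟩
        simp only [AddMemClass.mk_add_mk] at hF ⊢
        simp only [hg, hF]
        module
      map_smul' := by
        rintro c ⟨ψ, hψ⟩
        have hg : c • ψ - (μ * valueAtZero (c • ψ)) • green n s ω =
            c • (ψ - (μ * valueAtZero ψ) • green n s ω) := by
          rw [(hψ.2.1.smul c).2]; module
        have hF := (fracLaplacian n s).map_smul c ⟨_, hψ.2.2⟩
        simp only [SetLike.mk_smul_mk, RingHom.id_apply] at hF ⊢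
        simp only [hg, hF]
        module }

/-- The values of `(‖(-Δ)^{s/2} u‖² + ω ‖u‖²) / ‖u‖_∞²` over Schwartz functions `u ≠ 0`. The
condition `u ∈ D((-Δ)^{s/2})` holds automatically for `s ≥ 0`. -/
def sobolevQuotients (n : ℕ) (s ω : ℝ) : Set ℝ :=
  {J | ∃ u : 𝓢(Space n, ℂ), u ≠ 0 ∧
    ∃ f : (fracLaplacian n (s / 2)).domain, (f : L2 n) = u.toLp 2 ∧
      J = (‖fracLaplacian n (s / 2) f‖ ^ 2 + ω * ‖(f : L2 n)‖ ^ 2) /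
        ‖u.toBoundedContinuousFunction‖ ^ 2}

/-- The Sobolev constant `c²(ω) = inf (‖(-Δ)^{s/2} u‖² + ω ‖u‖²) / ‖u‖_∞²`. -/
def cSq (n : ℕ) (s ω : ℝ) : ℝ := sInf (sobolevQuotients n s ω)

/-- The standing wave profile `φ_ω`, with Fourier transform
`(∫ dξ / ((2π|ξ|)^{2s} + ω))^{-(1 + 1/(2σ))} / ((2π|ξ|)^{2s} + ω)`. -/
def standingWave (n : ℕ) (s ω σ : ℝ) : L2 n :=
  (((∫ ξ : Space n, greenSymbol s ω ξ) ^ (-(1 + 1 / (2 * σ))) : ℝ) : ℂ) • green n s ω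

/-- `L₋ = (-Δ)^s + ω - |φ_ω(0)|^{2σ} δ₀`. -/
def Lminus (n : ℕ) (s ω σ : ℝ) : L2 n →ₗ.[ℂ] L2 n :=
  deltaOp n s ω (‖valueAtZero (standingWave n s ω σ)‖ ^ (2 * σ))

/-- `L₊ = (-Δ)^s + ω - (2σ+1) |φ_ω(0)|^{2σ} δ₀`. -/
def Lplus (n : ℕ) (s ω σ : ℝ) : L2 n →ₗ.[ℂ] L2 n :=
  deltaOp n s ω ((2 * σ + 1) * ‖valueAtZero (standingWave n s ω σ)‖ ^ (2 * σ))

/-! ### Spectral notions for unbounded operators -/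

section Spectral

variable {H : Type*} [NormedAddCommGroup H] [InnerProductSpace ℂ H]

/-- The resolvent set: `A - z` has a bounded two-sided inverse. -/
def resolventSet (A : H →ₗ.[ℂ] H) : Set ℂ :=
  {z | ∃ R : H →L[ℂ] H,
    (∀ f : H, ∃ h : R f ∈ A.domain, A ⟨R f, h⟩ - z • R f = f) ∧
    ∀ ψ : A.domain, R (A ψ - z • (ψ : H)) = ψ}

/-- The spectrum of an unbounded operator. -/
def spec (A : H →ₗ.[ℂ] H) : Set ℂ := (resolventSet A)ᶜ

/-- The eigenspace `{ψ ∈ D(A) : A ψ = z ψ}`. -/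
def eigenspace (A : H →ₗ.[ℂ] H) (z : ℂ) : Submodule ℂ H where
  carrier := {ψ | ∃ h : ψ ∈ A.domain, A ⟨ψ, h⟩ = z • ψ}
  zero_mem' := ⟨A.domain.zero_mem, by rw [smul_zero]; exact A.map_zero⟩
  add_mem' := by
    rintro ψ χ ⟨h, h'⟩ ⟨k, k'⟩
    refine ⟨A.domain.add_mem h k, ?_⟩
    rw [smul_add, ← h', ← k']
    exact A.map_add ⟨ψ, h⟩ ⟨χ, k⟩
  smul_mem' := by
    rintro c ψ ⟨h, h'⟩
    refine ⟨A.domain.smul_mem c h, ?_⟩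
    rw [smul_comm, ← h']
    exact A.map_smul c ⟨ψ, h⟩

/-- `z` is a simple eigenvalue of `A`, with eigenfunction `Ψ`. -/
def IsSimpleEigenvalue (A : H →ₗ.[ℂ] H) (z : ℂ) (Ψ : H) : Prop :=
  Ψ ≠ 0 ∧ eigenspace A z = Submodule.span ℂ {Ψ}

/-- `A ≥ 0` in the sense of quadratic forms. -/
def IsNonneg (A : H →ₗ.[ℂ] H) : Prop :=
  ∀ ψ : A.domain, 0 ≤ (inner ℂ (A ψ) (ψ : H)).re

/-- `A ≥ b` on the orthogonal complement of `Ψ`, in the sense of quadratic forms. -/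
def BoundedBelowOnPerp (A : H →ₗ.[ℂ] H) (Ψ : H) (b : ℝ) : Prop :=
  ∀ ψ : A.domain, inner ℂ Ψ (ψ : H) = 0 → b * ‖(ψ : H)‖ ^ 2 ≤ (inner ℂ (A ψ) (ψ : H)).re

end Spectral

/-- The half-line `[a, ∞)` inside `ℂ`. -/
def halfLine (a : ℝ) : Set ℂ := {z | ∃ t : ℝ, a ≤ t ∧ z = t}

end

end DeltaSchrodinger

namespace DeltaSchrodinger

noncomputable section

/-! ### Inverse Fourier transform of integrable functions in `L²` -/

/-! On the Fourier side `δ₀` becomes integration, so `L_μ` is multiplication by `symbol + ω` minus a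
rank-one perturbation: `L_μ ψ = χ` means `(symbol + ω) ψ̂ = χ̂ + μ ∫ ψ̂` (`deltaOp_spec`,
`deltaOp_of_fourier`). Off `[ω, ∞)` the equation `(L_μ - z) ψ = f` is then solved explicitly unless
`μ ∫ (symbol + ω - z)⁻¹ = 1` (`mem_resolventSet_deltaOp`). Nonreal `z` cannot satisfy this
condition. For real `z = ω - t` it reads `μ I(t) = 1` with `I = greenIntegral n s`, a strictly
decreasing power of `t` that takes every positive value. Hence there is exactly one solution `t₀`,
and `ω - t₀` is the only spectral point outside `[ω, ∞)`, with eigenfunction `green n s t₀`.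

A symmetric operator with a real point in its resolvent set is self-adjoint. The bound on the
orthogonal complement is a weighted Cauchy–Schwarz inequality (`mul_norm_integral_sq_le`). The same
inequality gives one half of `cSq = I(ω)⁻¹`; the other half approximates the extremal Green function
by Schwartz functions. Comparing `μ` with `cSq` thus amounts to comparing `t₀` with `ω`, and
`|φ_ω(0)|^{2σ} = cSq` makes `Lminus` the critical case and `Lplus` a supercritical one. -/

theorem ae_eq_fourierInv_of_integrable {n : ℕ} {ψ : L2 n}
    (h : Integrable (𝓕 ψ : L2 n) volume) :
    ψ =ᵐ[volume] 𝓕⁻ ((𝓕 ψ : L2 n) : Space n → ℂ) := by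
  set H : L2 n := 𝓕 ψ with hH
  have hψ : ψ = 𝓕⁻ H := (FourierTransform.fourierInv_fourier_eq ψ).symm
  have hcont : Continuous (𝓕⁻ (H : Space n → ℂ)) := by
    rw [Real.fourierInv_eq_fourier_comp_neg]
    exact VectorFourier.fourierIntegral_continuous Real.continuous_fourierChar
      (by exact continuous_inner) h.comp_neg
  have hl := (Lp.memLp ψ).locallyIntegrable (by norm_num)
  -- Both functions are tested against compactly supported smooth `g`. Each pairing equals `∫ 𝓕⁻ v ·
  -- H`: for `ψ` by duality of tempered distributions, for the integral transform by Fubini.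
  have hz := ae_eq_zero_of_integral_contDiff_smul_eq_zero (hl.sub hcont.locallyIntegrable)
    (fun g g_smooth g_cpt => by
      have hg₁ : HasCompactSupport (Complex.ofRealCLM ∘ g) := g_cpt.comp_left rfl
      have hg₂ : ContDiff ℝ ((⊤ : ℕ∞) : WithTop ℕ∞) (Complex.ofRealCLM ∘ g) := by fun_prop
      set v : 𝓢(Space n, ℂ) := hg₁.toSchwartzMap hg₂ with hv
      have hvg : ∀ x, v x = (g x : ℂ) := fun x => rfl
      have i1 : Integrable (fun x => g x • ψ x) volume :=
        hl.integrable_smul_left_of_hasCompactSupport g_smooth.continuous g_cpt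
      have i2 : Integrable (fun x => g x • 𝓕⁻ (H : Space n → ℂ) x) volume :=
        hcont.locallyIntegrable.integrable_smul_left_of_hasCompactSupport g_smooth.continuous g_cpt
      simp only [Pi.sub_apply, smul_sub]
      rw [integral_sub i1 i2, sub_eq_zero]
      have e1 : ∫ x, g x • ψ x = ∫ x, (𝓕⁻ v) x • H x := by
        have e := DFunLike.congr_fun (Lp.fourierInv_toTemperedDistribution_eq H) v
        rw [← hψ, TemperedDistribution.fourierInv_apply] at e
        simp only [Lp.toTemperedDistribution_apply] at e
        rw [e]
        simp [hvg]
      have e2 : ∫ x, g x • 𝓕⁻ (H : Space n → ℂ) x = ∫ x, (𝓕⁻ v) x • H x := by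
        -- The exchange identity concerns the forward transform, hence the reflected test function:
        -- its forward transform is `𝓕⁻ v`.
        have := VectorFourier.integral_fourierIntegral_smul_eq_flip (μ := volume) (ν := volume)
          (e := Real.fourierChar) (L := innerₗ (Space n)) (f := fun x => v (-x))
          (g := (H : Space n → ℂ))
          Real.continuous_fourierChar (by exact continuous_inner) v.integrable.comp_neg h
        rw [flip_innerₗ] at this
        rw [SchwartzMap.fourierInv_coe, Real.fourierInv_eq_fourier_comp_neg,
          Real.fourierInv_eq_fourier_comp_neg]
        refine Eq.trans ?_ this.symm
        rw [← integral_neg_eq_self]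
        congr 1
        ext x
        rw [← Real.fourierInv_eq_fourier_comp_neg, Real.fourierInv_eq_fourier_neg, neg_neg, hvg]
        simp only [Complex.real_smul, smul_eq_mul]
        rfl
      rw [e1, e2])
  filter_upwards [hz] with x hx
  exact sub_eq_zero.1 hx

/-- This turns the point evaluation in the domain of `deltaOp` into the linear functional `∫ ψ̂`. -/
theorem hasContinuousRep_of_integrable {n : ℕ} {ψ : L2 n}
    (h : Integrable (𝓕 ψ : L2 n) volume) :
    HasContinuousRep ψ ∧ valueAtZero ψ = ∫ ξ, (𝓕 ψ : L2 n) ξ := by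
  have hcont : Continuous (𝓕⁻ ((𝓕 ψ : L2 n) : Space n → ℂ)) := by
    rw [Real.fourierInv_eq_fourier_comp_neg]
    exact VectorFourier.fourierIntegral_continuous Real.continuous_fourierChar
      (by exact continuous_inner) h.comp_neg
  refine ⟨⟨_, hcont, ae_eq_fourierInv_of_integrable h⟩, ?_⟩
  rw [valueAtZero_eq hcont (ae_eq_fourierInv_of_integrable h), Real.fourierInv_eq]
  simp

/-! ### The integral of the Green symbol -/

theorem symbol_smul {n : ℕ} (s : ℝ) {R : ℝ} (hR : 0 ≤ R) (ξ : Space n) :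
    symbol s (R • ξ) = R ^ (2 * s) * symbol s ξ := by
  rw [symbol, symbol, norm_smul, Real.norm_of_nonneg hR, ← Real.mul_rpow hR (by positivity)]
  congr 1
  ring

theorem measurable_greenSymbol {n : ℕ} (s lam : ℝ) :
    Measurable (greenSymbol (n := n) s lam) := by
  unfold greenSymbol
  exact measurable_const.div ((measurable_symbol s).add_const lam)

theorem greenSymbol_pos {n : ℕ} {s lam : ℝ} (hlam : 0 < lam) (ξ : Space n) :
    0 < greenSymbol s lam ξ := by
  have := symbol_nonneg s ξ
  unfold greenSymbol
  positivity

theorem integrable_greenSymbol {n : ℕ} {s lam : ℝ} (hs : (n : ℝ) / 2 < s) (hlam : 0 < lam) :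
    Integrable (greenSymbol (n := n) s lam) volume := by
  have hs0 : 0 < s := lt_of_le_of_lt (by positivity) hs
  have hfin : (Module.finrank ℝ (Space n) : ℝ) < 2 * s := by
    rw [finrank_euclideanSpace_fin]; linarith
  have hI := (integrable_rpow_neg_one_add_norm_sq (E := Space n) (μ := volume) hfin).const_mul
    (2 ^ s * (1 + 1 / lam))
  refine hI.mono' (measurable_greenSymbol s lam).aestronglyMeasurable ?_
  filter_upwards with ξ
  have hsn := symbol_nonneg s ξ
  have hw := one_add_norm_sq_rpow_le hs0.le ξ
  have hp : (0 : ℝ) < (1 + ‖ξ‖ ^ 2) ^ s := by positivity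
  rw [Real.norm_of_nonneg (greenSymbol_pos hlam ξ).le, neg_div, mul_div_cancel_left₀ _ two_ne_zero,
    greenSymbol, Real.rpow_neg (by positivity), ← div_eq_mul_inv,
    div_le_div_iff₀ (by positivity) hp, one_mul]
  refine hw.trans ?_
  rw [mul_assoc]
  gcongr
  have : (1 + 1 / lam) * (symbol s ξ + lam) = symbol s ξ + lam + symbol s ξ / lam + 1 := by
    field_simp; ring
  rw [this]
  have : 0 ≤ symbol s ξ / lam := by positivity
  linarith

/-- The value `∫ dξ / ((2π|ξ|)^{2s} + t)` of the Green function at the origin. -/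
def greenIntegral (n : ℕ) (s t : ℝ) : ℝ := ∫ ξ : Space n, greenSymbol s t ξ

theorem greenIntegral_pos {n : ℕ} {s t : ℝ} (hs : (n : ℝ) / 2 < s) (ht : 0 < t) :
    0 < greenIntegral n s t := by
  refine (integral_pos_iff_support_of_nonneg (fun ξ => (greenSymbol_pos ht ξ).le)
    (integrable_greenSymbol hs ht)).2 ?_
  have : Function.support (greenSymbol (n := n) s t) = Set.univ :=
    Set.eq_univ_of_forall fun ξ => (greenSymbol_pos ht ξ).ne'
  rw [this]
  exact Measure.measure_univ_pos.2 (NeZero.ne _)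

/-- Rescaling `ξ` by `R = t^{1/(2s)}` pulls `t` out of the symbol. The exponent is negative exactly
because `n < 2s`, so monotonicity and surjectivity onto `(0, ∞)` are read off the power law without
limit arguments. -/
theorem greenIntegral_eq {n : ℕ} {s t : ℝ} (hs : (n : ℝ) / 2 < s) (ht : 0 < t) :
    greenIntegral n s t = t ^ ((n : ℝ) / (2 * s) - 1) * greenIntegral n s 1 := by
  have hs0 : 0 < s := lt_of_le_of_lt (by positivity) hs
  set R : ℝ := t ^ (1 / (2 * s)) with hR
  have hR0 : 0 < R := by positivity
  have hRt : R ^ (2 * s) = t := by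
    rw [hR, ← Real.rpow_mul ht.le, one_div_mul_cancel (by positivity), Real.rpow_one]
  have hscale : ∀ ξ : Space n, greenSymbol s t (R • ξ) = t⁻¹ * greenSymbol s 1 ξ := by
    intro ξ
    have := symbol_nonneg s ξ
    rw [greenSymbol, greenSymbol, symbol_smul s hR0.le, hRt]
    field_simp
  have h := Measure.integral_comp_smul volume (greenSymbol (n := n) s t) R
  simp only [hscale, integral_const_mul, finrank_euclideanSpace_fin, smul_eq_mul] at h
  rw [abs_of_pos (by positivity)] at h
  have hRn : R ^ n = t ^ ((n : ℝ) / (2 * s)) := by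
    rw [hR, ← Real.rpow_natCast, ← Real.rpow_mul ht.le]
    congr 1
    field_simp
  rw [Real.rpow_sub_one ht.ne', ← hRn, greenIntegral, greenIntegral, div_mul_eq_mul_div,
    eq_div_iff ht.ne']
  field_simp at h
  linarith

theorem exponent_neg {n : ℕ} {s : ℝ} (hs : (n : ℝ) / 2 < s) : (n : ℝ) / (2 * s) - 1 < 0 := by
  have hs0 : 0 < s := lt_of_le_of_lt (by positivity) hs
  rw [sub_neg, div_lt_one (by positivity)]
  linarith

theorem greenIntegral_strictAntiOn {n : ℕ} {s : ℝ} (hs : (n : ℝ) / 2 < s) :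
    StrictAntiOn (greenIntegral n s) (Set.Ioi 0) := by
  intro a ha b hb hab
  rw [greenIntegral_eq hs ha, greenIntegral_eq hs hb]
  exact mul_lt_mul_of_pos_right (Real.rpow_lt_rpow_of_neg ha hab (exponent_neg hs))
    (greenIntegral_pos hs one_pos)

theorem exists_greenIntegral_eq {n : ℕ} {s y : ℝ} (hs : (n : ℝ) / 2 < s) (hy : 0 < y) :
    ∃ t, 0 < t ∧ greenIntegral n s t = y := by
  have h1 := greenIntegral_pos (n := n) hs one_pos
  have he := exponent_neg hs
  refine ⟨(y / greenIntegral n s 1) ^ ((n : ℝ) / (2 * s) - 1)⁻¹, by positivity, ?_⟩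
  rw [greenIntegral_eq hs (by positivity), ← Real.rpow_mul (by positivity),
    inv_mul_cancel₀ he.ne, Real.rpow_one, div_mul_cancel₀ _ h1.ne']

/-! ### The graph of `L_μ` on the Fourier side -/

section Multiplier

variable {n : ℕ} {s ω : ℝ} {h F : L2 n} {c : ℂ}

/-- Here `h` and `F` stand for the transforms of `ψ` and `L_μ ψ`. The constant `c` stays free, since
it can be identified with `μ ∫ h` only once `h` is known to be integrable. -/
theorem ae_eq_greenSymbol_mul (hω : 0 < ω)
    (H : ∀ᵐ ξ, ((symbol s ξ + ω : ℝ) : ℂ) * h ξ = F ξ + c) :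
    ∀ᵐ ξ, h ξ = (greenSymbol s ω ξ : ℂ) * (F ξ + c) := by
  filter_upwards [H] with ξ hξ
  have : symbol s ξ + ω ≠ 0 := by have := symbol_nonneg s ξ; positivity
  have : ((symbol s ξ + ω : ℝ) : ℂ) ≠ 0 := by exact_mod_cast this
  rw [← hξ, greenSymbol, Complex.ofReal_div, Complex.ofReal_one, one_div,
    inv_mul_cancel_left₀ this]

theorem integrable_of_symbol_mul (hs : (n : ℝ) / 2 < s) (hω : 0 < ω)
    (H : ∀ᵐ ξ, ((symbol s ξ + ω : ℝ) : ℂ) * h ξ = F ξ + c) : Integrable h volume := by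
  have h1 : Integrable (fun ξ => (greenSymbol s ω ξ : ℂ) * F ξ) volume :=
    (memLp_greenSymbol hs hω).integrable_mul (Lp.memLp F)
  have h2 : Integrable (fun ξ : Space n => (greenSymbol s ω ξ : ℂ) * c) volume :=
    (integrable_greenSymbol hs hω).ofReal.mul_const c
  refine (h1.add h2).congr ?_
  filter_upwards [ae_eq_greenSymbol_mul hω H] with ξ hξ
  rw [hξ, Pi.add_apply, mul_add]

/-- The integrand is `‖h‖ ‖F + c‖`: the product `‖h‖ ‖F‖` is integrable by Cauchy–Schwarz, and `‖h‖
‖c‖` because `h` is in `L¹`. -/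
theorem integrable_symbol_mul_norm_sq (hs : (n : ℝ) / 2 < s) (hω : 0 < ω)
    (H : ∀ᵐ ξ, ((symbol s ξ + ω : ℝ) : ℂ) * h ξ = F ξ + c) :
    Integrable (fun ξ => (symbol s ξ + ω) * ‖h ξ‖ ^ 2) volume := by
  have h1 : Integrable (fun ξ => ‖h ξ‖ * ‖F ξ‖) volume :=
    (Lp.memLp h).norm.integrable_mul (Lp.memLp F).norm
  have h2 : Integrable (fun ξ => ‖h ξ‖ * ‖c‖) volume :=
    (integrable_of_symbol_mul hs hω H).norm.mul_const _
  refine (h1.add h2).mono' ?_ ?_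
  · exact ((measurable_symbol s).add_const ω).aestronglyMeasurable.mul ((Lp.memLp h).1.norm.pow 2)
  · filter_upwards [H] with ξ hξ
    have hp : 0 < symbol s ξ + ω := by have := symbol_nonneg s ξ; positivity
    have := congrArg norm hξ
    rw [norm_mul, Complex.norm_of_nonneg hp.le] at this
    rw [Real.norm_of_nonneg (by positivity), Pi.add_apply, ← mul_add, sq, ← mul_assoc, this,
      mul_comm]
    gcongr
    exact norm_add_le _ _

end Multiplier

variable {n : ℕ} {s ω : ℝ} (μ : ℝ)

/-- The factor `symbol + ω` cancels `greenSymbol s ω`, so the singular part `c • green n s ω` of `ψ`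
contributes just the constant `c`. -/
theorem deltaOp_spec (hs : (n : ℝ) / 2 < s) (hω : 0 < ω) (ψ : (deltaOp n s ω μ).domain) :
    ∀ᵐ ξ, ((symbol s ξ + ω : ℝ) : ℂ) * (𝓕 (ψ : L2 n) : L2 n) ξ =
      (𝓕 (deltaOp n s ω μ ψ) : L2 n) ξ + μ * ∫ η, (𝓕 (ψ : L2 n) : L2 n) η := by
  set c : ℂ := μ * valueAtZero (ψ : L2 n) with hc
  set k : L2 n := (ψ : L2 n) - c • green n s ω with hk
  have hkd : k ∈ (fracLaplacian n s).domain := ψ.2.2.2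
  have hA : deltaOp n s ω μ ψ = fracLaplacian n s ⟨k, hkd⟩ + (ω : ℂ) • k := rfl
  have hFk : (𝓕 k : L2 n) = 𝓕 (ψ : L2 n) - c • 𝓕 (green n s ω) := by
    have : (ψ : L2 n) = k + c • green n s ω := by rw [hk]; abel
    rw [this, FourierTransform.fourier_add, FourierTransform.fourier_smul, add_sub_cancel_right]
  have key : ∀ᵐ ξ, ((symbol s ξ + ω : ℝ) : ℂ) * (𝓕 (ψ : L2 n) : L2 n) ξ =
      (𝓕 (deltaOp n s ω μ ψ) : L2 n) ξ + c := by
    rw [hA, FourierTransform.fourier_add, FourierTransform.fourier_smul]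
    filter_upwards [Lp.coeFn_add (𝓕 (fracLaplacian n s ⟨k, hkd⟩) : L2 n) ((ω : ℂ) • 𝓕 k),
      Lp.coeFn_smul (ω : ℂ) (𝓕 k : L2 n), fourier_fracLaplacian ⟨k, hkd⟩,
      Lp.coeFn_sub (𝓕 (ψ : L2 n) : L2 n) (c • 𝓕 (green n s ω)),
      Lp.coeFn_smul c (𝓕 (green n s ω) : L2 n), fourier_green (n := n) hs hω] with ξ h1 h2 h3 h4 h5 h6
    have hp : symbol s ξ + ω ≠ 0 := by have := symbol_nonneg s ξ; positivity
    have hp : ((symbol s ξ : ℂ) + ω) ≠ 0 := by exact_mod_cast hp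
    rw [h1, Pi.add_apply, h2, Pi.smul_apply, h3, hFk, h4, Pi.sub_apply, h5, Pi.smul_apply, h6, greenSymbol]
    simp only [smul_eq_mul]
    push_cast
    field_simp
    ring
  -- The equation with unspecified `c` already makes `ψ̂` integrable, which then identifies
  -- `valueAtZero ψ` with `∫ ψ̂`.
  rwa [hc, (hasContinuousRep_of_integrable (integrable_of_symbol_mul hs hω key)).2] at key

/-- Converse of `deltaOp_spec`. The Fourier equation alone yields all the domain conditions:
continuity from integrability, `H^s` from finite energy, and the regular part from `(symbol + ω) ĝ =
χ̂ ∈ L²`. -/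
theorem deltaOp_of_fourier (hs : (n : ℝ) / 2 < s) (hω : 0 < ω) {ψ χ : L2 n}
    (H : ∀ᵐ ξ, ((symbol s ξ + ω : ℝ) : ℂ) * (𝓕 ψ : L2 n) ξ =
      (𝓕 χ : L2 n) ξ + μ * ∫ η, (𝓕 ψ : L2 n) η) :
    ∃ h : ψ ∈ (deltaOp n s ω μ).domain, deltaOp n s ω μ ⟨ψ, h⟩ = χ := by
  have hs0 : 0 < s := lt_of_le_of_lt (by positivity) hs
  have hint := integrable_of_symbol_mul hs hω H
  obtain ⟨hrep, hval⟩ := hasContinuousRep_of_integrable hint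
  have hsob : MemSobolev s 2 (ψ : 𝓢'(Space n, ℂ)) := by
    rw [memSobolev_iff_memLp]
    have hm : AEStronglyMeasurable
        (fun ξ => (((1 + ‖ξ‖ ^ 2) ^ (s / 2) : ℝ) : ℂ) * (𝓕 ψ : L2 n) ξ) volume :=
      (Measurable.aestronglyMeasurable (by fun_prop)).mul (Lp.memLp (𝓕 ψ : L2 n)).1
    rw [← memLp_norm_iff hm, memLp_two_iff_integrable_sq hm.norm]
    -- The constant combines `(1 + ‖ξ‖²)^s ≤ 2^s (1 + symbol)` with `1 + x ≤ (1 + 1/ω)(x + ω)` for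
    -- `x ≥ 0`.
    refine ((integrable_symbol_mul_norm_sq hs hω H).const_mul (2 ^ s * (1 + 1 / ω))).mono'
      (hm.norm.pow 2) ?_
    filter_upwards with ξ
    have hsn := symbol_nonneg s ξ
    rw [Real.norm_of_nonneg (by positivity), norm_mul, Complex.norm_of_nonneg (by positivity),
      mul_pow, ← Real.rpow_natCast ((1 + ‖ξ‖ ^ 2) ^ (s / 2)) 2, ← Real.rpow_mul (by positivity),
      Nat.cast_ofNat, div_mul_cancel₀ _ two_ne_zero, ← mul_assoc]
    gcongr
    refine (one_add_norm_sq_rpow_le hs0.le ξ).trans ?_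
    rw [mul_assoc]
    gcongr
    have : (1 + 1 / ω) * (symbol s ξ + ω) = symbol s ξ + ω + symbol s ξ / ω + 1 := by
      field_simp; ring
    rw [this]
    have : 0 ≤ symbol s ξ / ω := by positivity
    linarith
  set c : ℂ := μ * valueAtZero ψ with hc
  have hFk : (𝓕 (ψ - c • green n s ω) : L2 n) = 𝓕 ψ - c • 𝓕 (green n s ω) := by
    have : ψ = (ψ - c • green n s ω) + c • green n s ω := by abel
    nth_rw 2 [this]
    rw [FourierTransform.fourier_add, FourierTransform.fourier_smul, add_sub_cancel_right]
  have hk : ∀ᵐ ξ, ((symbol s ξ + ω : ℝ) : ℂ) * (𝓕 (ψ - c • green n s ω) : L2 n) ξ =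
      (𝓕 χ : L2 n) ξ := by
    rw [hFk]
    filter_upwards [H, Lp.coeFn_sub (𝓕 ψ : L2 n) (c • 𝓕 (green n s ω)),
      Lp.coeFn_smul c (𝓕 (green n s ω) : L2 n), fourier_green (n := n) hs hω] with ξ h1 h2 h3 h4
    have hp : symbol s ξ + ω ≠ 0 := by have := symbol_nonneg s ξ; positivity
    have hp : ((symbol s ξ : ℂ) + ω) ≠ 0 := by exact_mod_cast hp
    rw [← hval, ← hc] at h1
    rw [h2, Pi.sub_apply, h3, Pi.smul_apply, h4, mul_sub, h1, greenSymbol]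
    simp only [smul_eq_mul]
    push_cast
    field_simp
    ring
  have hkd : ψ - c • green n s ω ∈ (fracLaplacian n s).domain := by
    rw [mem_fracLaplacian_domain]
    refine (Lp.memLp (𝓕 χ : L2 n)).mono ((Complex.measurable_ofReal.comp
      (measurable_symbol s)).aestronglyMeasurable.mul (Lp.memLp _).1) ?_
    filter_upwards [hk] with ξ h1
    have hsn := symbol_nonneg s ξ
    rw [← h1, norm_mul, norm_mul, Complex.norm_of_nonneg hsn,
      Complex.norm_of_nonneg (by positivity)]
    gcongr
    linarith
  refine ⟨⟨hsob, hrep, hkd⟩, ?_⟩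
  change fracLaplacian n s ⟨ψ - c • green n s ω, hkd⟩ + (ω : ℂ) • (ψ - c • green n s ω) = χ
  apply (Lp.fourierTransformₗᵢ (Space n) ℂ).injective
  change (𝓕 (fracLaplacian n s ⟨ψ - c • green n s ω, hkd⟩ +
    (ω : ℂ) • (ψ - c • green n s ω)) : L2 n) = 𝓕 χ
  rw [FourierTransform.fourier_add, FourierTransform.fourier_smul]
  refine Lp.ext ?_
  filter_upwards [Lp.coeFn_add (𝓕 (fracLaplacian n s ⟨ψ - c • green n s ω, hkd⟩) : L2 n)
      ((ω : ℂ) • 𝓕 (ψ - c • green n s ω)), Lp.coeFn_smul (ω : ℂ) (𝓕 (ψ - c • green n s ω) : L2 n),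
    fourier_fracLaplacian ⟨ψ - c • green n s ω, hkd⟩, hk] with ξ h1 h2 h3 h4
  rw [h1, Pi.add_apply, h2, Pi.smul_apply, h3, ← h4]
  simp only [smul_eq_mul]
  push_cast
  ring

/-! ### Symmetric operators with a real point in the resolvent set -/

section Symmetric

variable {H : Type*} [NormedAddCommGroup H] [InnerProductSpace ℂ H]

/-- Since `A - t` is onto, a vector orthogonal to its range vanishes. As `t` is real, symmetry
carries over to `A - t`, and this gives both the density of the domain and `A.adjoint ≤ A`. -/
theorem isSelfAdjoint_of_isFormalAdjoint [CompleteSpace H] {A : H →ₗ.[ℂ] H}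
    (hA : A.IsFormalAdjoint A) {t : ℝ} (ht : (t : ℂ) ∈ resolventSet A) : IsSelfAdjoint A := by
  obtain ⟨R, hR, -⟩ := ht
  have hsymm : ∀ x y : A.domain, inner ℂ (A x - (t : ℂ) • (x : H)) (y : H) =
      inner ℂ (x : H) (A y - (t : ℂ) • (y : H)) := by
    intro x y
    rw [inner_sub_left, inner_sub_right, inner_smul_left, inner_smul_right, Complex.conj_ofReal,
      hA x y]
  have hzero : ∀ x : H, (∀ y : A.domain, inner ℂ x (A y - (t : ℂ) • (y : H)) = 0) → x = 0 := by
    intro x hx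
    obtain ⟨h, e⟩ := hR x
    have := hx ⟨R x, h⟩
    rw [e] at this
    exact inner_self_eq_zero.1 this
  -- For `v` orthogonal to the domain, `⟪R v, (A - t) y⟫ = ⟪v, y⟫ = 0`, so `R v = 0` and `v = (A -
  -- t) (R v) = 0`.
  have hdense : Dense (A.domain : Set H) := by
    rw [Submodule.dense_iff_topologicalClosure_eq_top, Submodule.topologicalClosure_eq_top_iff,
      Submodule.eq_bot_iff]
    intro v hv
    obtain ⟨h, e⟩ := hR v
    have h0 : R v = 0 := hzero _ fun y => by
      rw [← hsymm ⟨R v, h⟩ y, e, ← inner_conj_symm, (Submodule.mem_orthogonal _ _).1 hv y y.2,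
        map_zero]
    have h1 : (⟨R v, h⟩ : A.domain) = 0 := Subtype.ext h0
    rw [← e, h1, h0]
    simp
  -- The witness is `x = R ((A* - t) y)`: the difference `y - x` is orthogonal to the range of `A -
  -- t`.
  have key : ∀ y : A.adjoint.domain, ∃ x : A.domain, (y : H) = x ∧ A.adjoint y = A x := by
    intro y
    obtain ⟨h, e⟩ := hR (A.adjoint y - (t : ℂ) • (y : H))
    have h0 : (y : H) - R (A.adjoint y - (t : ℂ) • (y : H)) = 0 := hzero _ fun w => by
      rw [inner_sub_left, ← hsymm ⟨_, h⟩ w, e, inner_sub_right, inner_sub_left,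
        inner_smul_left, inner_smul_right, Complex.conj_ofReal,
        LinearPMap.adjoint_isFormalAdjoint hdense y w, sub_self]
    have h1 := sub_eq_zero.1 h0
    refine ⟨⟨_, h⟩, h1, ?_⟩
    have e' := sub_eq_sub_iff_add_eq_add.1 e
    exact (add_right_cancel (e'.trans (congrArg (A.adjoint y + (t : ℂ) • ·) h1.symm))).symm
  have hle : A.adjoint ≤ A := by
    refine ⟨fun y hy => ?_, fun y z hyz => ?_⟩
    · obtain ⟨x, hx, -⟩ := key ⟨y, hy⟩
      exact (show y = x from hx) ▸ x.2
    · obtain ⟨x, hx, e⟩ := key y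
      rw [e]
      congr 1
      exact Subtype.ext (hx.symm.trans hyz)
  exact LinearPMap.isSelfAdjoint_def.2 (le_antisymm hle (hA.le_adjoint hdense))

theorem eigenspace_eq_bot_of_mem_resolventSet {A : H →ₗ.[ℂ] H} {z : ℂ}
    (hz : z ∈ resolventSet A) : eigenspace A z = ⊥ := by
  obtain ⟨R, -, hR⟩ := hz
  rw [Submodule.eq_bot_iff]
  rintro ψ ⟨h, e⟩
  have := hR ⟨ψ, h⟩
  rwa [e, sub_self, map_zero, eq_comm] at this

end Symmetric

/-! ### The resolvent of `L_μ` -/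

/-- The function `1 / ((2π|ξ|)^{2s} + ω - z)`. -/
def resolventSymbol {n : ℕ} (s ω : ℝ) (z : ℂ) (ξ : Space n) : ℂ :=
  (((symbol s ξ + ω : ℝ) : ℂ) - z)⁻¹

section Resolvent

variable {n : ℕ} {s ω : ℝ} {z : ℂ}

theorem resolventSymbol_ofReal (t : ℝ) (ξ : Space n) :
    resolventSymbol s ω (t : ℂ) ξ = (greenSymbol s (ω - t) ξ : ℂ) := by
  rw [resolventSymbol, greenSymbol, one_div, ← Complex.ofReal_sub, ← Complex.ofReal_inv,
    add_sub_assoc]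

theorem measurable_resolventSymbol : Measurable (resolventSymbol (n := n) s ω z) :=
  ((Complex.measurable_ofReal.comp ((measurable_symbol s).add_const ω)).sub_const z).inv

theorem symbol_add_sub_ne_zero (hz : z ∉ halfLine ω) (ξ : Space n) :
    ((symbol s ξ + ω : ℝ) : ℂ) - z ≠ 0 := by
  intro h
  exact hz ⟨symbol s ξ + ω, by linarith [symbol_nonneg s ξ], (sub_eq_zero.1 h).symm⟩

/-- If `z` has distance at least `d > 0` from the half-line, then `x ≤ |x - z| + |z| ≤ (1 + |z|/d)
|x - z|` for `x = symbol + ω`. All integrability of the resolvent symbol is inherited from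
`greenSymbol`. -/
theorem exists_norm_resolventSymbol_le (hω : 0 < ω) (hz : z ∉ halfLine ω) :
    ∃ C : ℝ, ∀ ξ : Space n, ‖resolventSymbol s ω z ξ‖ ≤ C * greenSymbol s ω ξ := by
  obtain ⟨d, hd, hdz⟩ : ∃ d : ℝ, 0 < d ∧ ∀ x : ℝ, ω ≤ x → d ≤ ‖(x : ℂ) - z‖ := by
    by_cases him : z.im = 0
    · refine ⟨ω - z.re, ?_, fun x hx => ?_⟩
      · by_contra hcon
        exact hz ⟨z.re, by linarith, Complex.ext rfl (by simpa using him)⟩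
      · have := Complex.re_le_norm ((x : ℂ) - z)
        rw [Complex.sub_re, Complex.ofReal_re] at this
        linarith
    · refine ⟨|z.im|, abs_pos.2 him, fun x hx => ?_⟩
      simpa using Complex.abs_im_le_norm ((x : ℂ) - z)
  refine ⟨1 + ‖z‖ / d, fun ξ => ?_⟩
  have hsn := symbol_nonneg s ξ
  set x := symbol s ξ + ω with hx
  have hx0 : 0 < x := by positivity
  have h1 := hdz x (by linarith)
  have h2 : x ≤ ‖(x : ℂ) - z‖ + ‖z‖ := by
    have := norm_add_le ((x : ℂ) - z) z
    rwa [sub_add_cancel, Complex.norm_of_nonneg hx0.le] at this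
  have h3 : ‖z‖ ≤ ‖z‖ / d * ‖(x : ℂ) - z‖ := by
    rw [div_mul_eq_mul_div, le_div_iff₀ hd]
    gcongr
  rw [resolventSymbol, greenSymbol, norm_inv, mul_one_div, ← hx, inv_eq_one_div,
    div_le_div_iff₀ (hd.trans_le h1) hx0]
  linarith

theorem memLp_resolventSymbol (hs : (n : ℝ) / 2 < s) (hω : 0 < ω) (hz : z ∉ halfLine ω) :
    MemLp (resolventSymbol (n := n) s ω z) 2 volume := by
  obtain ⟨C, hC⟩ := exists_norm_resolventSymbol_le (n := n) (s := s) hω hz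
  refine ((memLp_greenSymbol hs hω).norm.const_mul C).mono
    measurable_resolventSymbol.aestronglyMeasurable ?_
  filter_upwards with ξ
  refine (hC ξ).trans ((le_abs_self _).trans ?_)
  simp

theorem integrable_resolventSymbol (hs : (n : ℝ) / 2 < s) (hω : 0 < ω) (hz : z ∉ halfLine ω) :
    Integrable (resolventSymbol (n := n) s ω z) volume := by
  obtain ⟨C, hC⟩ := exists_norm_resolventSymbol_le (n := n) (s := s) hω hz
  exact ((integrable_greenSymbol hs hω).const_mul C).mono'
    measurable_resolventSymbol.aestronglyMeasurable (Filter.Eventually.of_forall hC)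

theorem memLp_top_resolventSymbol (hω : 0 < ω) (hz : z ∉ halfLine ω) :
    MemLp (resolventSymbol (n := n) s ω z) ⊤ volume := by
  obtain ⟨C, hC⟩ := exists_norm_resolventSymbol_le (n := n) (s := s) hω hz
  refine memLp_top_of_bound measurable_resolventSymbol.aestronglyMeasurable (|C| * ω⁻¹)
    (Filter.Eventually.of_forall fun ξ => (hC ξ).trans ?_)
  have h1 := greenSymbol_pos (s := s) hω ξ
  have h2 : greenSymbol s ω ξ ≤ ω⁻¹ := by
    rw [greenSymbol, one_div]
    exact inv_anti₀ hω (by linarith [symbol_nonneg s ξ])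
  gcongr
  exact le_abs_self C

/-- Krein's formula. With `b` the resolvent symbol, `(L_μ - z) ψ = f` reads `ψ̂ = b (f̂ + c)`, `c =
μ ∫ ψ̂`. Integrating gives `c D = μ ∫ b f̂` with `D = 1 - μ ∫ b`, so the inverse is multiplication
by `b` plus a rank-one operator. Boundedness uses `b ∈ L^∞` for the first and `b ∈ L²` for the
second. -/
theorem mem_resolventSet_deltaOp {μ : ℝ} (hs : (n : ℝ) / 2 < s) (hω : 0 < ω)
    (hz : z ∉ halfLine ω) (hμ : μ * ∫ ξ : Space n, resolventSymbol s ω z ξ ≠ 1) :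
    z ∈ resolventSet (deltaOp n s ω μ) := by
  set b : Space n → ℂ := resolventSymbol s ω z with hb
  have hb2 := memLp_resolventSymbol (n := n) hs hω hz
  have hbt := memLp_top_resolventSymbol (n := n) (s := s) hω hz
  set D : ℂ := 1 - μ * ∫ ξ, b ξ with hD
  have hD0 : D ≠ 0 := sub_ne_zero.2 (Ne.symm hμ)
  let ℓ : L2 n →L[ℂ] ℂ := (ContinuousLinearMap.mul ℂ ℂ).lpPairing volume 2 2 (hb2.toLp b)
  let M : L2 n →L[ℂ] L2 n := (ContinuousLinearMap.mul ℂ ℂ).holderL volume ⊤ 2 2 (hbt.toLp b)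
  let T : L2 n →L[ℂ] L2 n := M + ((μ / D : ℂ) • ℓ).smulRight (hb2.toLp b)
  let Φ := Lp.fourierTransformₗᵢ (Space n) ℂ
  let R : L2 n →L[ℂ] L2 n :=
    (Φ.symm.toContinuousLinearEquiv : L2 n →L[ℂ] L2 n) ∘L T ∘L
      (Φ.toContinuousLinearEquiv : L2 n →L[ℂ] L2 n)
  have hℓ : ∀ F : L2 n, ℓ F = ∫ ξ, b ξ * F ξ := by
    intro F
    refine (ContinuousLinearMap.lpPairing_eq_integral _ _ _).trans (integral_congr_ae ?_)
    filter_upwards [hb2.coeFn_toLp] with ξ h1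
    rw [h1]
    rfl
  have hT : ∀ F : L2 n, ∀ᵐ ξ, T F ξ = b ξ * (F ξ + μ / D * ℓ F) := by
    intro F
    have hTF : T F = M F + (μ / D * ℓ F) • hb2.toLp b := rfl
    rw [hTF]
    filter_upwards [Lp.coeFn_add (M F) ((μ / D * ℓ F) • hb2.toLp b),
      Lp.coeFn_smul (μ / D * ℓ F) (hb2.toLp b), hb2.coeFn_toLp, hbt.coeFn_toLp,
      ContinuousLinearMap.coeFn_holder (r := 2) (ContinuousLinearMap.mul ℂ ℂ) (hbt.toLp b) F]
      with ξ h1 h2 h3 h4 h5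
    have h5' : M F ξ = b ξ * F ξ := by
      refine Eq.trans h5 ?_
      rw [h4]
      rfl
    rw [h1, Pi.add_apply, h5', h2, Pi.smul_apply, h3, smul_eq_mul]
    ring
  have hFR : ∀ f : L2 n, (𝓕 (R f) : L2 n) = T (𝓕 f) := fun f => Φ.apply_symm_apply _
  have hint : ∀ (F : L2 n) (c : ℂ), ∫ ξ, b ξ * (F ξ + c) = ℓ F + c * ∫ ξ, b ξ := by
    intro F c
    have i1 : Integrable (fun ξ => b ξ * F ξ) volume := hb2.integrable_mul (Lp.memLp F)
    have i2 := (integrable_resolventSymbol (n := n) hs hω hz).mul_const c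
    simp only [mul_add]
    rw [integral_add i1 i2, hℓ, integral_mul_const, mul_comm c]
  have hbinv : ∀ ξ, (((symbol s ξ + ω : ℝ) : ℂ) - z) * b ξ = 1 := fun ξ =>
    mul_inv_cancel₀ (symbol_add_sub_ne_zero hz ξ)
  refine ⟨R, fun f => ?_, fun ψ => ?_⟩
  -- Self-consistency: the constant built into `T` is indeed `μ` times the integral of the output.
  · have hI : μ * ∫ ξ, (𝓕 (R f) : L2 n) ξ = μ / D * ℓ (𝓕 f) := by
      rw [hFR, integral_congr_ae (hT _), hint]
      have : (∫ ξ, b ξ) * μ = 1 - D := by rw [hD]; ring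
      have hDD : μ / D * D = (μ : ℂ) := div_mul_cancel₀ _ hD0
      linear_combination (μ / D * ℓ (𝓕 f)) * this - ℓ (𝓕 f) * hDD
    obtain ⟨h, e⟩ := deltaOp_of_fourier μ hs hω (ψ := R f) (χ := f + z • R f) (by
      rw [hI, FourierTransform.fourier_add, FourierTransform.fourier_smul]
      filter_upwards [Lp.coeFn_add (𝓕 f : L2 n) (z • 𝓕 (R f)), Lp.coeFn_smul z (𝓕 (R f) : L2 n),
        hT (𝓕 f)] with ξ h1 h2 h3
      rw [h1, Pi.add_apply, h2, Pi.smul_apply, hFR, h3, smul_eq_mul]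
      linear_combination ((𝓕 f : L2 n) ξ + μ / D * ℓ (𝓕 f)) * hbinv ξ)
    exact ⟨h, by rw [e, add_sub_cancel_right]⟩
  · set c : ℂ := μ * ∫ ξ, (𝓕 (ψ : L2 n) : L2 n) ξ with hc
    set F : L2 n := 𝓕 (deltaOp n s ω μ ψ - z • (ψ : L2 n)) with hF
    have hFe : F = 𝓕 (deltaOp n s ω μ ψ) - z • 𝓕 (ψ : L2 n) :=
      (Φ.map_sub _ _).trans (congrArg _ (Φ.map_smul _ _))
    have h0 : ∀ᵐ ξ, (𝓕 (ψ : L2 n) : L2 n) ξ = b ξ * (F ξ + c) := by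
      rw [hFe]
      filter_upwards [deltaOp_spec μ hs hω ψ,
        Lp.coeFn_sub (𝓕 (deltaOp n s ω μ ψ) : L2 n) (z • 𝓕 (ψ : L2 n)),
        Lp.coeFn_smul z (𝓕 (ψ : L2 n) : L2 n)] with ξ h1 h2 h3
      rw [h2, Pi.sub_apply, h3, Pi.smul_apply, smul_eq_mul]
      linear_combination -((𝓕 (ψ : L2 n) : L2 n) ξ) * hbinv ξ + b ξ * h1
    have hcD : c = μ / D * ℓ F := by
      have h1 : c = μ * (ℓ F + c * ∫ ξ, b ξ) := by
        rw [← hint, ← integral_congr_ae h0]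
      have h2 : c * D = μ * ℓ F := by rw [hD]; linear_combination h1
      rw [div_mul_eq_mul_div, eq_div_iff hD0, h2]
    apply Φ.injective
    refine (hFR _).trans (Lp.ext ?_)
    have hTF := hT F
    rw [← hcD] at hTF
    filter_upwards [hTF, h0] with ξ h1 h2
    exact h1.trans h2.symm

/-- The imaginary part of `∫ b` is `Im z · ∫ |b|²`, nonzero for nonreal `z`. So `μ ∫ b = 1` would
force `μ = 0`, which is absurd. -/
theorem integral_resolventSymbol_ne {μ : ℝ} (hs : (n : ℝ) / 2 < s) (hω : 0 < ω)
    (hz : z ∉ halfLine ω) (him : z.im ≠ 0) :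
    μ * ∫ ξ : Space n, resolventSymbol s ω z ξ ≠ 1 := by
  intro h
  have hbi := integrable_resolventSymbol (n := n) hs hω hz
  have h1 : (∫ ξ : Space n, resolventSymbol s ω z ξ).im =
      z.im * ∫ ξ : Space n, ‖resolventSymbol s ω z ξ‖ ^ 2 := by
    refine (Complex.imCLM.integral_comp_comm hbi).symm.trans ?_
    rw [← integral_const_mul]
    congr 1
    ext ξ
    rw [Complex.imCLM_apply, resolventSymbol, Complex.inv_im, norm_inv, inv_pow,
      ← Complex.normSq_eq_norm_sq]
    simp [div_eq_mul_inv]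
  have h2 : 0 < ∫ ξ : Space n, ‖resolventSymbol s ω z ξ‖ ^ 2 := by
    have hpos : ∀ ξ : Space n, 0 < ‖resolventSymbol s ω z ξ‖ ^ 2 := fun ξ => by
      have := inv_ne_zero (symbol_add_sub_ne_zero (s := s) hz ξ)
      have : resolventSymbol s ω z ξ ≠ 0 := this
      positivity
    refine (integral_pos_iff_support_of_nonneg (fun ξ => (hpos ξ).le)
      ((memLp_two_iff_integrable_sq_norm measurable_resolventSymbol.aestronglyMeasurable).1
        (memLp_resolventSymbol hs hω hz))).2 ?_
    rw [Set.eq_univ_of_forall fun ξ => Function.mem_support.2 (hpos ξ).ne']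
    exact Measure.measure_univ_pos.2 (NeZero.ne _)
  have h3 := congrArg Complex.im h
  have h4 := congrArg Complex.re h
  rw [Complex.im_ofReal_mul, h1, Complex.one_im] at h3
  rcases mul_eq_zero.1 h3 with h5 | h5
  · rw [h5] at h4
    simp at h4
  · exact (mul_ne_zero him h2.ne') h5

theorem integral_resolventSymbol_ofReal (t : ℝ) :
    ∫ ξ : Space n, resolventSymbol s ω (t : ℂ) ξ = (greenIntegral n s (ω - t) : ℂ) := by
  simp only [resolventSymbol_ofReal]
  exact integral_ofReal

theorem mem_resolventSet_of_ne {μ t₀ : ℝ} (hs : (n : ℝ) / 2 < s) (hω : 0 < ω)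
    (ht₀ : 0 < t₀) (hμ : μ * greenIntegral n s t₀ = 1) (hz : z ∉ halfLine ω)
    (hne : z ≠ ((ω - t₀ : ℝ) : ℂ)) : z ∈ resolventSet (deltaOp n s ω μ) := by
  refine mem_resolventSet_deltaOp hs hω hz ?_
  by_cases him : z.im = 0
  · obtain ⟨t, rfl⟩ : ∃ t : ℝ, z = t := ⟨z.re, Complex.ext rfl (by simpa using him)⟩
    rw [integral_resolventSymbol_ofReal]
    intro h
    have h : μ * greenIntegral n s (ω - t) = 1 := by exact_mod_cast h
    have ht : t < ω := by
      by_contra hcon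
      exact hz ⟨t, not_lt.1 hcon, rfl⟩
    have h2 := mul_left_cancel₀ (left_ne_zero_of_mul_eq_one hμ) (h.trans hμ.symm)
    have h3 := (greenIntegral_strictAntiOn hs).injOn (Set.mem_Ioi.2 (sub_pos.2 ht)) ht₀ h2
    exact hne (by rw [← h3, sub_sub_cancel])
  · exact integral_resolventSymbol_ne hs hω hz him

theorem ofReal_notMem_halfLine {t : ℝ} (ht : t < ω) : (t : ℂ) ∉ halfLine ω := by
  rintro ⟨x, hx, h⟩
  rw [Complex.ofReal_inj] at h
  linarith

end Resolvent

/-! ### The quadratic form of `L_μ` -/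

/-- Weighted Cauchy–Schwarz, proved through `2λ‖f‖ ≤ λ² a + q`. It serves the nonnegativity of the
form, the bound on the orthogonal complement and the Sobolev inequality. -/
theorem mul_norm_integral_sq_le {α : Type*} [MeasurableSpace α] {ν : Measure α} {μ : ℝ}
    (hμ : 0 < μ) {f : α → ℂ} {a q : α → ℝ} (hf : Integrable f ν) (ha : Integrable a ν)
    (hq : Integrable q ν) (ha0 : ∀ x, 0 ≤ a x) (hq0 : ∀ x, 0 ≤ q x) (hI : μ * ∫ x, a x ∂ν ≤ 1)
    (hle : ∀ᵐ x ∂ν, ‖f x‖ ^ 2 ≤ a x * q x) : μ * ‖∫ x, f x ∂ν‖ ^ 2 ≤ ∫ x, q x ∂ν := by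
  set X := ‖∫ x, f x ∂ν‖ with hX
  have hX0 : 0 ≤ X := norm_nonneg _
  -- The parameter `λ = μ X` lets `μ ∫ a ≤ 1` bound the first term by `μ X²`, while the left side is
  -- at least `2 μ X²`.
  have h1 : 2 * (μ * X) * ∫ x, ‖f x‖ ∂ν ≤ (μ * X) ^ 2 * ∫ x, a x ∂ν + ∫ x, q x ∂ν := by
    rw [← integral_const_mul, ← integral_const_mul, ← integral_add (ha.const_mul _) hq]
    refine integral_mono_ae (hf.norm.const_mul _) ((ha.const_mul _).add hq) ?_
    filter_upwards [hle] with x hx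
    have := ha0 x
    have := hq0 x
    refine abs_le_of_sq_le_sq' (b := (μ * X) ^ 2 * a x + q x) ?_ (by positivity) |>.2
    nlinarith [sq_nonneg ((μ * X) ^ 2 * a x - q x),
      mul_le_mul_of_nonneg_left hx (sq_nonneg (μ * X))]
  have h2 : X ≤ ∫ x, ‖f x‖ ∂ν := norm_integral_le_integral_norm f
  have h3 : 2 * (μ * X) * X ≤ 2 * (μ * X) * ∫ x, ‖f x‖ ∂ν := by gcongr
  have h4 : (μ * X ^ 2) * (μ * ∫ x, a x ∂ν) ≤ (μ * X ^ 2) * 1 := by gcongr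
  nlinarith

section Form

variable {n : ℕ} {s ω : ℝ} (μ : ℝ)

theorem norm_sq_eq_integral_fourier (ψ : L2 n) :
    ‖ψ‖ ^ 2 = ∫ ξ, ‖(𝓕 ψ : L2 n) ξ‖ ^ 2 := by
  rw [← Lp.norm_fourier_eq, ← Complex.ofReal_inj, Complex.ofReal_pow]
  refine (inner_self_eq_norm_sq_to_K (𝕜 := ℂ) (𝓕 ψ : L2 n)).symm.trans ?_
  rw [L2.inner_def, ← integral_complex_ofReal]
  congr 1
  ext ξ
  rw [inner_self_eq_norm_sq_to_K]
  simp

theorem inner_deltaOp (hs : (n : ℝ) / 2 < s) (hω : 0 < ω) (ψ χ : (deltaOp n s ω μ).domain) :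
    inner ℂ (deltaOp n s ω μ ψ) (χ : L2 n) =
      (∫ ξ, ((symbol s ξ + ω : ℝ) : ℂ) *
        ((starRingEnd ℂ) ((𝓕 (ψ : L2 n) : L2 n) ξ) * (𝓕 (χ : L2 n) : L2 n) ξ)) -
      μ * ((starRingEnd ℂ) (∫ ξ, (𝓕 (ψ : L2 n) : L2 n) ξ) * ∫ ξ, (𝓕 (χ : L2 n) : L2 n) ξ) := by
  set F : L2 n := 𝓕 (deltaOp n s ω μ ψ) with hF
  set h : L2 n := 𝓕 (ψ : L2 n) with hh
  set k : L2 n := 𝓕 (χ : L2 n) with hk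
  have i1 : Integrable (fun ξ => (starRingEnd ℂ) (F ξ) * k ξ) volume := by
    refine (L2.integrable_inner (𝕜 := ℂ) F k).congr (Filter.Eventually.of_forall fun ξ => ?_)
    simp [mul_comm]
  have i2 : Integrable k volume := integrable_of_symbol_mul hs hω (deltaOp_spec μ hs hω χ)
  have e : inner ℂ (deltaOp n s ω μ ψ) (χ : L2 n) = ∫ ξ, (starRingEnd ℂ) (F ξ) * k ξ := by
    rw [← Lp.inner_fourier_eq, L2.inner_def]
    congr 1
    ext ξ
    rw [RCLike.inner_apply, mul_comm]
  -- The weighted integral is rewritten as a whole by `deltaOp_spec`; it is split afterwards, when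
  -- both summands are visibly integrable.
  have e2 : ∫ ξ, ((symbol s ξ + ω : ℝ) : ℂ) * ((starRingEnd ℂ) (h ξ) * k ξ) =
      ∫ ξ, ((starRingEnd ℂ) (F ξ) * k ξ + μ * (starRingEnd ℂ) (∫ ξ, h ξ) * k ξ) := by
    refine integral_congr_ae ?_
    filter_upwards [deltaOp_spec μ hs hω ψ] with ξ h1
    have h2 := congrArg (starRingEnd ℂ) h1
    simp only [map_mul, map_add, Complex.conj_ofReal] at h2
    rw [← mul_assoc, h2, add_mul]
  rw [e, e2, integral_add i1 (i2.const_mul _), integral_const_mul]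
  ring

theorem re_inner_deltaOp (hs : (n : ℝ) / 2 < s) (hω : 0 < ω) (ψ : (deltaOp n s ω μ).domain) :
    (inner ℂ (deltaOp n s ω μ ψ) (ψ : L2 n)).re =
      (∫ ξ, (symbol s ξ + ω) * ‖(𝓕 (ψ : L2 n) : L2 n) ξ‖ ^ 2) -
      μ * ‖∫ ξ, (𝓕 (ψ : L2 n) : L2 n) ξ‖ ^ 2 := by
  rw [inner_deltaOp μ hs hω]
  simp only [Complex.conj_mul']
  rw [← Complex.ofReal_re ((∫ ξ, (symbol s ξ + ω) * ‖(𝓕 (ψ : L2 n) : L2 n) ξ‖ ^ 2) -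
      μ * ‖∫ ξ, (𝓕 (ψ : L2 n) : L2 n) ξ‖ ^ 2), Complex.ofReal_sub, ← integral_complex_ofReal]
  push_cast
  rfl

theorem isFormalAdjoint_deltaOp (hs : (n : ℝ) / 2 < s) (hω : 0 < ω) :
    (deltaOp n s ω μ).IsFormalAdjoint (deltaOp n s ω μ) := by
  intro ψ χ
  rw [← inner_conj_symm ((ψ : (deltaOp n s ω μ).domain) : L2 n), inner_deltaOp μ hs hω,
    inner_deltaOp μ hs hω, map_sub]
  congr 1
  · rw [← integral_conj]
    congr 1
    ext ξ
    simp only [map_mul, Complex.conj_conj, Complex.conj_ofReal]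
    ring
  · simp only [map_mul, Complex.conj_conj, Complex.conj_ofReal]
    ring

end Form

/-! ### The spectrum of `L_μ` -/

section Spectrum

variable {n : ℕ} {s ω μ t₀ : ℝ}

theorem isSelfAdjoint_deltaOp (hs : (n : ℝ) / 2 < s) (hω : 0 < ω)
    (ht₀ : 0 < t₀) (hμ : μ * greenIntegral n s t₀ = 1) : IsSelfAdjoint (deltaOp n s ω μ) := by
  -- Any real number below `ω` other than `ω - t₀` would do.
  refine isSelfAdjoint_of_isFormalAdjoint (isFormalAdjoint_deltaOp μ hs hω) (t := ω - t₀ - 1)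
    (mem_resolventSet_of_ne hs hω ht₀ hμ (ofReal_notMem_halfLine (by linarith)) ?_)
  rw [Ne, Complex.ofReal_inj]
  linarith

theorem spec_deltaOp_subset (hs : (n : ℝ) / 2 < s) (hω : 0 < ω)
    (ht₀ : 0 < t₀) (hμ : μ * greenIntegral n s t₀ = 1) :
    spec (deltaOp n s ω μ) \ {((ω - t₀ : ℝ) : ℂ)} ⊆ halfLine ω := by
  rintro z ⟨hz, hne⟩
  by_contra hcon
  exact hz (mem_resolventSet_of_ne hs hω ht₀ hμ hcon hne)

theorem eigenspace_deltaOp_eq_bot (hs : (n : ℝ) / 2 < s) (hω : 0 < ω)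
    (ht₀ : 0 < t₀) (hμ : μ * greenIntegral n s t₀ = 1) {t : ℝ} (ht : t < ω) (hne : t ≠ ω - t₀) :
    eigenspace (deltaOp n s ω μ) (t : ℂ) = ⊥ :=
  eigenspace_eq_bot_of_mem_resolventSet (mem_resolventSet_of_ne hs hω ht₀ hμ
    (ofReal_notMem_halfLine ht) fun h => hne (Complex.ofReal_inj.1 h))

theorem integral_fourier_green (hs : (n : ℝ) / 2 < s) (ht₀ : 0 < t₀) :
    ∫ ξ, (𝓕 (green n s t₀) : L2 n) ξ = (greenIntegral n s t₀ : ℂ) := by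
  rw [integral_congr_ae (fourier_green hs ht₀), greenIntegral]
  exact integral_ofReal

/-- The eigenvalue equation is `(symbol + t₀) ψ̂ = μ ∫ ψ̂`, so `ψ̂` is a multiple of `greenSymbol s
t₀`; conversely that function solves it because `μ I(t₀) = 1`. -/
theorem isSimpleEigenvalue_deltaOp (hs : (n : ℝ) / 2 < s) (hω : 0 < ω)
    (ht₀ : 0 < t₀) (hμ : μ * greenIntegral n s t₀ = 1) :
    IsSimpleEigenvalue (deltaOp n s ω μ) ((ω - t₀ : ℝ) : ℂ) (green n s t₀) := by
  have hI := integral_fourier_green (n := n) hs ht₀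
  refine ⟨fun h0 => ?_, le_antisymm ?_ ?_⟩
  · have hF0 : (𝓕 (0 : L2 n) : L2 n) = 0 := (Lp.fourierTransformₗᵢ (Space n) ℂ).map_zero
    rw [h0, hF0, integral_congr_ae (Lp.coeFn_zero ℂ 2 volume)] at hI
    simp only [Pi.zero_apply, integral_zero] at hI
    exact (greenIntegral_pos hs ht₀).ne (by exact_mod_cast hI)
  · rintro ψ ⟨h, e⟩
    have hsp := deltaOp_spec μ hs hω ⟨ψ, h⟩
    rw [e, FourierTransform.fourier_smul] at hsp
    set c : ℂ := μ * ∫ η, (𝓕 ψ : L2 n) η with hc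
    refine Submodule.mem_span_singleton.2 ⟨c, ?_⟩
    apply (Lp.fourierTransformₗᵢ (Space n) ℂ).injective
    change (𝓕 (c • green n s t₀) : L2 n) = 𝓕 ψ
    rw [FourierTransform.fourier_smul]
    refine Lp.ext ?_
    filter_upwards [hsp, Lp.coeFn_smul ((ω - t₀ : ℝ) : ℂ) (𝓕 ψ : L2 n),
      Lp.coeFn_smul c (𝓕 (green n s t₀) : L2 n), fourier_green (n := n) hs ht₀] with ξ h1 h2 h3 h4
    have hp : symbol s ξ + t₀ ≠ 0 := by have := symbol_nonneg s ξ; positivity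
    have hp : (symbol s ξ : ℂ) + t₀ ≠ 0 := by exact_mod_cast hp
    rw [h2, Pi.smul_apply, smul_eq_mul] at h1
    rw [h3, Pi.smul_apply, h4, smul_eq_mul, greenSymbol]
    push_cast at h1 ⊢
    field_simp
    linear_combination -h1
  · rw [Submodule.span_singleton_le_iff_mem]
    refine deltaOp_of_fourier μ hs hω ?_
    rw [hI, FourierTransform.fourier_smul, ← Complex.ofReal_mul, hμ]
    filter_upwards [Lp.coeFn_smul ((ω - t₀ : ℝ) : ℂ) (𝓕 (green n s t₀) : L2 n),
      fourier_green (n := n) hs ht₀] with ξ h1 h2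
    have hp : symbol s ξ + t₀ ≠ 0 := by have := symbol_nonneg s ξ; positivity
    have hp : (symbol s ξ : ℂ) + t₀ ≠ 0 := by exact_mod_cast hp
    rw [h1, Pi.smul_apply, h2, smul_eq_mul, greenSymbol]
    push_cast
    field_simp
    ring

/-- After the `ω` terms cancel, the claim is `μ |∫ h|² ≤ ∫ symbol |h|²`. With `g = greenSymbol s
t₀`, orthogonality gives `∫ g h = 0`, so `h` may be replaced by `h - t₀ g h = symbol/(symbol + t₀) ·
h` under the integral. Cauchy–Schwarz with weights `g` and `symbol |h|²` then applies, as `μ ∫ g =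
1`. -/
theorem boundedBelowOnPerp_deltaOp (hs : (n : ℝ) / 2 < s) (hω : 0 < ω) (hμ0 : 0 < μ)
    (ht₀ : 0 < t₀) (hμ : μ * greenIntegral n s t₀ = 1) :
    BoundedBelowOnPerp (deltaOp n s ω μ) (green n s t₀) ω := by
  intro ψ hψ
  have hsp := deltaOp_spec μ hs hω ψ
  rw [re_inner_deltaOp μ hs hω, norm_sq_eq_integral_fourier]
  rw [← Lp.inner_fourier_eq, L2.inner_def] at hψ
  set h : L2 n := 𝓕 (ψ : L2 n) with hh
  have hint : Integrable h volume := integrable_of_symbol_mul hs hω hsp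
  have hw := integrable_symbol_mul_norm_sq hs hω hsp
  have hn : Integrable (fun ξ => ω * ‖h ξ‖ ^ 2) volume :=
    ((memLp_two_iff_integrable_sq_norm (Lp.memLp h).1).1 (Lp.memLp h)).const_mul ω
  have hq : Integrable (fun ξ => symbol s ξ * ‖h ξ‖ ^ 2) volume := by
    refine (hw.sub hn).congr (Filter.Eventually.of_forall fun ξ => ?_)
    simp only [Pi.sub_apply]
    ring
  have hsplit : ∫ ξ, (symbol s ξ + ω) * ‖h ξ‖ ^ 2 =
      (∫ ξ, symbol s ξ * ‖h ξ‖ ^ 2) + ω * ∫ ξ, ‖h ξ‖ ^ 2 := by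
    rw [← integral_const_mul, ← integral_add hq hn]
    simp only [add_mul]
  have hperp : ∫ ξ, (greenSymbol s t₀ ξ : ℂ) * h ξ = 0 := by
    rw [← hψ]
    refine integral_congr_ae ?_
    filter_upwards [fourier_green (n := n) hs ht₀] with ξ h1
    rw [h1, RCLike.inner_apply, Complex.conj_ofReal, mul_comm]
  have hgh : Integrable (fun ξ => (greenSymbol s t₀ ξ : ℂ) * h ξ) volume :=
    (memLp_greenSymbol hs ht₀).integrable_mul (Lp.memLp h)
  have hf : Integrable (fun ξ => h ξ - t₀ * ((greenSymbol s t₀ ξ : ℂ) * h ξ)) volume :=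
    hint.sub (hgh.const_mul _)
  have hfI : ∫ ξ, (h ξ - t₀ * ((greenSymbol s t₀ ξ : ℂ) * h ξ)) = ∫ ξ, h ξ := by
    rw [integral_sub hint (hgh.const_mul _), integral_const_mul, hperp, mul_zero, sub_zero]
  have key := mul_norm_integral_sq_le hμ0 hf (integrable_greenSymbol hs ht₀) hq
    (fun ξ => (greenSymbol_pos ht₀ ξ).le)
    (fun ξ => mul_nonneg (symbol_nonneg s ξ) (sq_nonneg _)) hμ.le
    (Filter.Eventually.of_forall fun ξ => by
      have hsn := symbol_nonneg s ξ
      have hp : 0 < symbol s ξ + t₀ := by positivity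
      have h1 : h ξ - t₀ * ((greenSymbol s t₀ ξ : ℂ) * h ξ) =
          ((symbol s ξ / (symbol s ξ + t₀) : ℝ) : ℂ) * h ξ := by
        have hp' : (symbol s ξ : ℂ) + t₀ ≠ 0 := by exact_mod_cast hp.ne'
        rw [greenSymbol]
        push_cast
        field_simp
        ring
      -- This is `x² ≤ x` for `x = symbol / (symbol + t₀)` in `[0, 1]`.
      have h2 : (symbol s ξ / (symbol s ξ + t₀)) ^ 2 ≤
          greenSymbol s t₀ ξ * symbol s ξ := by
        rw [greenSymbol, div_pow, one_div_mul_eq_div, div_le_div_iff₀ (by positivity) hp]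
        nlinarith [mul_nonneg (mul_nonneg hsn ht₀.le) hp.le]
      rw [h1, norm_mul, Complex.norm_of_nonneg (by positivity), mul_pow, ← mul_assoc]
      gcongr)
  rw [hfI] at key
  rw [hsplit]
  linarith

theorem isNonneg_deltaOp (hs : (n : ℝ) / 2 < s) (hω : 0 < ω) (hμ0 : 0 < μ)
    (hμ : μ * greenIntegral n s ω = 1) : IsNonneg (deltaOp n s ω μ) := by
  intro ψ
  have hsp := deltaOp_spec μ hs hω ψ
  rw [re_inner_deltaOp μ hs hω, sub_nonneg]
  have hw : ∀ ξ : Space n, 0 < symbol s ξ + ω := fun ξ => by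
    have := symbol_nonneg s ξ
    positivity
  refine mul_norm_integral_sq_le hμ0 (integrable_of_symbol_mul hs hω hsp)
    (integrable_greenSymbol hs hω) (integrable_symbol_mul_norm_sq hs hω hsp)
    (fun ξ => (greenSymbol_pos hω ξ).le) (fun ξ => mul_nonneg (hw ξ).le (sq_nonneg _)) hμ.le
    (Filter.Eventually.of_forall fun ξ => ?_)
  rw [greenSymbol, ← mul_assoc, one_div_mul_cancel (hw ξ).ne', one_mul]

end Spectrum

/-! ### The Sobolev constant -/

section Sobolev

variable {n : ℕ} {s ω : ℝ}

theorem symbol_half_sq (s : ℝ) (ξ : Space n) : symbol (s / 2) ξ ^ 2 = symbol s ξ := by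
  rw [symbol, symbol, ← Real.rpow_natCast, ← Real.rpow_mul (by positivity)]
  congr 1
  push_cast
  ring

theorem fracLaplacian_half_norm_sq (u : 𝓢(Space n, ℂ)) (f : (fracLaplacian n (s / 2)).domain)
    (hf : (f : L2 n) = u.toLp 2) :
    Integrable (fun ξ => (symbol s ξ + ω) * ‖𝓕 u ξ‖ ^ 2) volume ∧
      ‖fracLaplacian n (s / 2) f‖ ^ 2 + ω * ‖(f : L2 n)‖ ^ 2 =
        ∫ ξ, (symbol s ξ + ω) * ‖𝓕 u ξ‖ ^ 2 := by
  have h𝓕 : ∀ᵐ ξ, (𝓕 (f : L2 n) : L2 n) ξ = 𝓕 u ξ := by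
    rw [hf, SchwartzMap.toLp_fourier_eq]
    exact (𝓕 u).coeFn_toLp 2 volume
  have hsq : ∀ᵐ ξ, ‖(𝓕 (fracLaplacian n (s / 2) f) : L2 n) ξ‖ ^ 2 =
      symbol s ξ * ‖𝓕 u ξ‖ ^ 2 := by
    filter_upwards [h𝓕, fourier_fracLaplacian f] with ξ h1 h2
    rw [h2, h1, norm_mul, Complex.norm_of_nonneg (symbol_nonneg _ _), mul_pow, symbol_half_sq]
  have hsq' : ∀ᵐ ξ, ‖(𝓕 (f : L2 n) : L2 n) ξ‖ ^ 2 = ‖𝓕 u ξ‖ ^ 2 := by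
    filter_upwards [h𝓕] with ξ h1
    rw [h1]
  have hi : ∀ g : L2 n, Integrable (fun ξ => ‖g ξ‖ ^ 2) volume := fun g =>
    (memLp_two_iff_integrable_sq_norm (Lp.memLp g).1).1 (Lp.memLp g)
  have i1 := (hi _).congr hsq
  have i2 := ((hi _).congr hsq').const_mul ω
  refine ⟨?_, ?_⟩
  · simp only [add_mul]
    exact i1.add i2
  · rw [norm_sq_eq_integral_fourier, norm_sq_eq_integral_fourier, integral_congr_ae hsq,
      integral_congr_ae hsq', ← integral_const_mul, ← integral_add i1 i2]
    simp only [add_mul]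

/-- Fourier inversion writes `u x` as an integral of `û` times a phase of modulus one;
Cauchy–Schwarz with the weight `symbol + ω` bounds it uniformly in `x`. -/
theorem inv_greenIntegral_le_of_mem (hs : (n : ℝ) / 2 < s) (hω : 0 < ω) {J : ℝ}
    (hJ : J ∈ sobolevQuotients n s ω) : (greenIntegral n s ω)⁻¹ ≤ J := by
  obtain ⟨u, hu, f, hf, rfl⟩ := hJ
  obtain ⟨hi, hN⟩ := fracLaplacian_half_norm_sq (s := s) (ω := ω) u f hf
  have hK := greenIntegral_pos (n := n) hs hω
  have hw : ∀ ξ : Space n, 0 < symbol s ξ + ω := fun ξ => by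
    have := symbol_nonneg s ξ
    positivity
  set N := ∫ ξ, (symbol s ξ + ω) * ‖𝓕 u ξ‖ ^ 2
  have hN0 : 0 ≤ N := integral_nonneg fun ξ => mul_nonneg (hw ξ).le (sq_nonneg _)
  have hx : ∀ x, ‖u x‖ ^ 2 ≤ greenIntegral n s ω * N := by
    intro x
    have hux : u x = ∫ ξ, Real.fourierChar (inner ℝ ξ x) • 𝓕 u ξ := by
      rw [← Real.fourierInv_eq, ← SchwartzMap.fourierInv_coe, FourierTransform.fourierInv_fourier_eq]
    have hint : Integrable (fun ξ => Real.fourierChar (inner ℝ ξ x) • 𝓕 u ξ) volume := by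
      refine (𝓕 u).integrable.norm.mono' ?_ (Filter.Eventually.of_forall fun ξ => ?_)
      · exact Continuous.aestronglyMeasurable (by fun_prop)
      · rw [Circle.norm_smul]
    have := mul_norm_integral_sq_le (inv_pos.2 hK) hint (integrable_greenSymbol hs hω) hi
      (fun ξ => (greenSymbol_pos hω ξ).le) (fun ξ => mul_nonneg (hw ξ).le (sq_nonneg _))
      (inv_mul_cancel₀ hK.ne').le (Filter.Eventually.of_forall fun ξ => by
        rw [Circle.norm_smul, greenSymbol, ← mul_assoc, one_div_mul_cancel (hw ξ).ne', one_mul])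
    rw [← hux] at this
    rwa [inv_mul_le_iff₀ hK] at this
  have hsup : ‖u.toBoundedContinuousFunction‖ ^ 2 ≤ greenIntegral n s ω * N := by
    refine (Real.le_sqrt (norm_nonneg _) (mul_nonneg hK.le hN0)).1 ?_
    refine (BoundedContinuousFunction.norm_le (Real.sqrt_nonneg _)).2 fun x => ?_
    exact Real.le_sqrt_of_sq_le (hx x)
  have hpos : 0 < ‖u.toBoundedContinuousFunction‖ := by
    rw [norm_pos_iff]
    intro h0
    apply hu
    ext x
    exact DFunLike.congr_fun h0 x
  rw [hN, le_div_iff₀ (by positivity), inv_mul_le_iff₀ hK]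
  exact hsup

/-- The measure `((2π|ξ|)^{2s} + ω) dξ`. -/
def sobolevMeasure (n : ℕ) (s ω : ℝ) : Measure (Space n) :=
  volume.withDensity fun ξ => ((symbol s ξ + ω).toNNReal : ℝ≥0∞)

theorem continuous_symbol (hs : 0 ≤ s) : Continuous (symbol (n := n) s) := by
  unfold symbol
  exact (continuous_const.mul continuous_norm).rpow_const fun _ => Or.inr (by linarith)

theorem measurable_weight :
    Measurable fun ξ : Space n => (symbol s ξ + ω).toNNReal :=
  ((measurable_symbol s).add_const ω).real_toNNReal

theorem smul_weight {E : Type*} [NormedAddCommGroup E] [NormedSpace ℝ E] (hω : 0 < ω)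
    (ξ : Space n) (y : E) : (symbol s ξ + ω).toNNReal • y = (symbol s ξ + ω) • y := by
  have := symbol_nonneg s ξ
  rw [NNReal.smul_def, Real.coe_toNNReal _ (by positivity)]

theorem integrable_sobolevMeasure_iff {E : Type*} [NormedAddCommGroup E] [NormedSpace ℝ E]
    (hω : 0 < ω) {f : Space n → E} :
    Integrable f (sobolevMeasure n s ω) ↔
      Integrable (fun ξ => (symbol s ξ + ω) • f ξ) volume := by
  rw [sobolevMeasure, integrable_withDensity_iff_integrable_smul measurable_weight]
  simp only [smul_weight hω]

theorem integral_sobolevMeasure {E : Type*} [NormedAddCommGroup E] [NormedSpace ℝ E]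
    (hω : 0 < ω) (f : Space n → E) :
    ∫ ξ, f ξ ∂(sobolevMeasure n s ω) = ∫ ξ, (symbol s ξ + ω) • f ξ := by
  rw [sobolevMeasure, integral_withDensity_eq_integral_smul measurable_weight]
  simp only [smul_weight hω]

/-- Lets Schwartz functions be viewed in `L²` of the weighted measure, for the density argument in
`exists_sobolevQuotient_lt`. -/
theorem hasTemperateGrowth_sobolevMeasure (hs : 0 ≤ s) (hω : 0 < ω) :
    (sobolevMeasure n s ω).HasTemperateGrowth := by
  -- The power `⌈2s⌉₊` absorbs the growth of the weight; the remaining `n + 1` gives integrability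
  -- in dimension `n`.
  refine ⟨⟨⌈2 * s⌉₊ + (n + 1), (integrable_sobolevMeasure_iff hω).2 ?_⟩⟩
  have hfin : (Module.finrank ℝ (Space n) : ℝ) < ((n + 1 : ℕ) : ℝ) := by
    rw [finrank_euclideanSpace_fin]; push_cast; linarith
  refine ((integrable_one_add_norm (E := Space n) (μ := volume) hfin).const_mul
    ((2 * Real.pi) ^ (2 * s) + ω)).mono' ?_ ?_
  · refine Measurable.aestronglyMeasurable ?_
    exact ((measurable_symbol s).add_const ω).smul (by fun_prop)
  · filter_upwards with ξ
    have hsn := symbol_nonneg s ξ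
    have h1 : (1 : ℝ) ≤ 1 + ‖ξ‖ := by linarith [norm_nonneg ξ]
    have h2 : symbol s ξ ≤ (2 * Real.pi) ^ (2 * s) * (1 + ‖ξ‖) ^ (⌈2 * s⌉₊ : ℝ) := by
      rw [symbol, Real.mul_rpow (by positivity) (norm_nonneg _)]
      gcongr
      calc ‖ξ‖ ^ (2 * s) ≤ (1 + ‖ξ‖) ^ (2 * s) :=
            Real.rpow_le_rpow (norm_nonneg _) (by linarith) (by linarith)
        _ ≤ _ := Real.rpow_le_rpow_of_exponent_le h1 (Nat.le_ceil _)
    have h3 : (1 : ℝ) ≤ (1 + ‖ξ‖) ^ (⌈2 * s⌉₊ : ℝ) := Real.one_le_rpow h1 (by positivity)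
    rw [Real.norm_of_nonneg (by positivity), smul_eq_mul, Nat.cast_add, neg_add,
      Real.rpow_add (by positivity), ← mul_assoc]
    gcongr
    rw [Real.rpow_neg (by positivity), ← div_eq_mul_inv, div_le_iff₀ (by positivity), add_mul]
    nlinarith

theorem isLocallyFiniteMeasure_sobolevMeasure (hs : 0 ≤ s) :
    IsLocallyFiniteMeasure (sobolevMeasure n s ω) := by
  unfold sobolevMeasure
  exact IsLocallyFiniteMeasure.withDensity_coe
    (continuous_real_toNNReal.comp ((continuous_symbol hs).add continuous_const))

/-- In `L²(ν)` the energy is `‖y‖²`, and `∫ y = ⟪G, y⟫` for the Green symbol `G`, where `‖G‖² = ⟪G,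
G⟫ = K`. Thus `‖y‖² < r |⟪G, y⟫|²` is an open condition satisfied at `G`, hence by some Schwartz
`v`. Its inverse transform `u` has `|u 0| = |∫ v|`, which bounds the supremum norm from below. -/
theorem exists_sobolevQuotient_lt (hs : (n : ℝ) / 2 < s) (hω : 0 < ω) {r : ℝ}
    (hr : (greenIntegral n s ω)⁻¹ < r) : ∃ J ∈ sobolevQuotients n s ω, J < r := by
  have hs0 : 0 < s := lt_of_le_of_lt (by positivity) hs
  have hK := greenIntegral_pos (n := n) hs hω
  set K := greenIntegral n s ω with hKdef
  set ν := sobolevMeasure n s ω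
  have : ν.HasTemperateGrowth := hasTemperateGrowth_sobolevMeasure hs0.le hω
  have : IsLocallyFiniteMeasure ν := isLocallyFiniteMeasure_sobolevMeasure hs0.le
  have hw : ∀ ξ : Space n, 0 < symbol s ξ + ω := fun ξ => by
    have := symbol_nonneg s ξ
    positivity
  have hwg : ∀ ξ : Space n, (symbol s ξ + ω) * greenSymbol s ω ξ = 1 := fun ξ =>
    mul_one_div_cancel (hw ξ).ne'
  have hg : MemLp (fun ξ : Space n => (greenSymbol s ω ξ : ℂ)) 2 ν := by
    have hm : Measurable (fun ξ : Space n => (greenSymbol s ω ξ : ℂ)) :=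
      Complex.measurable_ofReal.comp (measurable_greenSymbol s ω)
    rw [memLp_two_iff_integrable_sq_norm hm.aestronglyMeasurable, integrable_sobolevMeasure_iff hω]
    refine (integrable_greenSymbol hs hω).congr (Filter.Eventually.of_forall fun ξ => ?_)
    simp only [smul_eq_mul]
    rw [Complex.norm_of_nonneg (greenSymbol_pos hω ξ).le, sq, ← mul_assoc, hwg, one_mul]
  set G : Lp ℂ 2 ν := hg.toLp _ with hG
  have hinner : ∀ y : Lp ℂ 2 ν, inner ℂ G y = ∫ ξ, y ξ := by
    intro y
    rw [L2.inner_def]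
    have : ∫ ξ, inner ℂ (G ξ) (y ξ) ∂ν = ∫ ξ, (greenSymbol s ω ξ : ℂ) * y ξ ∂ν := by
      refine integral_congr_ae ?_
      filter_upwards [hg.coeFn_toLp] with ξ h1
      rw [hG, h1, RCLike.inner_apply, Complex.conj_ofReal, mul_comm]
    rw [this, integral_sobolevMeasure hω]
    congr 1
    ext ξ
    rw [Complex.real_smul, ← mul_assoc, ← Complex.ofReal_mul, hwg, Complex.ofReal_one, one_mul]
  have hnormsq : ∀ y : Lp ℂ 2 ν, ‖y‖ ^ 2 = ∫ ξ, (symbol s ξ + ω) * ‖y ξ‖ ^ 2 := by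
    intro y
    rw [← Complex.ofReal_inj, Complex.ofReal_pow]
    refine (inner_self_eq_norm_sq_to_K (𝕜 := ℂ) y).symm.trans ?_
    rw [L2.inner_def, integral_sobolevMeasure hω, ← integral_complex_ofReal]
    congr 1
    ext ξ
    rw [inner_self_eq_norm_sq_to_K]
    simp
  -- The density is positive everywhere, so `ν`-null sets are Lebesgue null.
  have hvol : ∀ y z : Space n → ℂ, y =ᵐ[ν] z → y =ᵐ[volume] z := by
    intro y z h
    have := (ae_withDensity_iff measurable_weight.coe_nnreal_ennreal).1 h
    filter_upwards [this] with ξ h1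
    exact h1 (by simpa using hw ξ)
  have hGK : ∫ ξ, G ξ = (K : ℂ) := by
    rw [integral_congr_ae (hvol _ _ hg.coeFn_toLp)]
    exact integral_ofReal
  have hGn : ‖G‖ ^ 2 = K := by
    have := inner_self_eq_norm_sq_to_K (𝕜 := ℂ) G
    rw [hinner, hGK] at this
    exact Complex.ofReal_injective (by simpa using this.symm)
  have hopen : IsOpen {y : Lp ℂ 2 ν | ‖y‖ ^ 2 < r * ‖inner ℂ G y‖ ^ 2} :=
    isOpen_lt (by fun_prop) (by fun_prop)
  have hne : G ∈ {y : Lp ℂ 2 ν | ‖y‖ ^ 2 < r * ‖inner ℂ G y‖ ^ 2} := by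
    change ‖G‖ ^ 2 < r * ‖inner ℂ G G‖ ^ 2
    rw [hGn, hinner, hGK, Complex.norm_of_nonneg hK.le]
    rw [inv_lt_iff_one_lt_mul₀ hK] at hr
    nlinarith
  obtain ⟨v, hv⟩ := (SchwartzMap.denseRange_toLpCLM (F := ℂ) (p := 2) (μ := ν)
    ENNReal.ofNat_ne_top).exists_mem_open hopen ⟨G, hne⟩
  change ‖v.toLp 2 ν‖ ^ 2 < r * ‖inner ℂ G (v.toLp 2 ν)‖ ^ 2 at hv
  have hvae : v.toLp 2 ν =ᵐ[volume] v := hvol _ _ (v.coeFn_toLp 2 ν)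
  rw [hinner, hnormsq, integral_congr_ae hvae] at hv
  have hv' : ∫ ξ, (symbol s ξ + ω) * ‖v.toLp 2 ν ξ‖ ^ 2 = ∫ ξ, (symbol s ξ + ω) * ‖v ξ‖ ^ 2 := by
    refine integral_congr_ae ?_
    filter_upwards [hvae] with ξ h1
    rw [h1]
  rw [hv'] at hv
  set u : 𝓢(Space n, ℂ) := 𝓕⁻ v with hu
  have huv : 𝓕 u = v := FourierTransform.fourier_fourierInv_eq v
  have hwv : Integrable (fun ξ => (symbol s ξ + ω) * ‖v ξ‖ ^ 2) volume :=
    (integrable_sobolevMeasure_iff hω).1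
      ((memLp_two_iff_integrable_sq_norm (v.memLp 2 ν).1).1 (v.memLp 2 ν))
  have hdom : (u.toLp 2 : L2 n) ∈ (fracLaplacian n (s / 2)).domain := by
    rw [mem_fracLaplacian_domain, SchwartzMap.toLp_fourier_eq, huv]
    have hm : AEStronglyMeasurable
        (fun ξ => (symbol (s / 2) ξ : ℂ) * (v.toLp 2 : L2 n) ξ) volume :=
      (Complex.measurable_ofReal.comp (measurable_symbol (s / 2))).aestronglyMeasurable.mul
        (Lp.memLp _).1
    rw [memLp_two_iff_integrable_sq_norm hm]
    refine hwv.mono' (hm.norm.pow 2) ?_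
    filter_upwards [v.coeFn_toLp 2 volume] with ξ h1
    rw [h1, Real.norm_of_nonneg (by positivity), norm_mul,
      Complex.norm_of_nonneg (symbol_nonneg _ _), mul_pow, symbol_half_sq]
    gcongr
    linarith
  have hu0 : u 0 = ∫ ξ, v ξ := by
    rw [hu, SchwartzMap.fourierInv_coe, Real.fourierInv_eq]
    simp
  have hle : ‖∫ ξ, v ξ‖ ≤ ‖u.toBoundedContinuousFunction‖ := by
    rw [← hu0]
    exact u.toBoundedContinuousFunction.norm_coe_le_norm 0
  have hN0 : 0 ≤ ∫ ξ, (symbol s ξ + ω) * ‖v ξ‖ ^ 2 :=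
    integral_nonneg fun ξ => mul_nonneg (hw ξ).le (sq_nonneg _)
  have hr0 : 0 < r := (inv_pos.2 hK).trans hr
  -- The strict inequality itself excludes `∫ v = 0`; this yields `u ≠ 0` and a nonzero denominator.
  have hpos : 0 < ‖∫ ξ, v ξ‖ ^ 2 := pos_of_mul_pos_right (hN0.trans_lt hv) hr0.le
  have hlt : ∫ ξ, (symbol s ξ + ω) * ‖v ξ‖ ^ 2 < r * ‖u.toBoundedContinuousFunction‖ ^ 2 :=
    hv.trans_le (by gcongr)
  refine ⟨_, ⟨u, ?_, ⟨_, hdom⟩, rfl, rfl⟩, ?_⟩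
  · intro h0
    rw [← hu0, h0] at hpos
    simp at hpos
  · rw [(fracLaplacian_half_norm_sq (s := s) (ω := ω) u ⟨_, hdom⟩ rfl).2, huv, div_lt_iff₀]
    · exact hlt
    · exact hpos.trans_le (by gcongr)

theorem cSq_eq (hs : (n : ℝ) / 2 < s) (hω : 0 < ω) : cSq n s ω = (greenIntegral n s ω)⁻¹ := by
  have hlb : (greenIntegral n s ω)⁻¹ ∈ lowerBounds (sobolevQuotients n s ω) :=
    fun J hJ => inv_greenIntegral_le_of_mem hs hω hJ
  -- Nonemptiness matters, as the real `sInf` of the empty set is `0`.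
  obtain ⟨J₀, hJ₀, -⟩ := exists_sobolevQuotient_lt (n := n) hs hω (lt_add_one _)
  refine le_antisymm (le_of_forall_gt fun r hr => ?_) (le_csInf ⟨J₀, hJ₀⟩ hlb)
  obtain ⟨J, hJ, hJr⟩ := exists_sobolevQuotient_lt hs hω hr
  exact (csInf_le ⟨_, hlb⟩ hJ).trans_lt hJr

/-- The value of the standing wave profile at the origin satisfies
`|φ_ω(0)|^{2σ} = c²(ω)`. -/
theorem norm_valueAtZero_standingWave_rpow (hs : (n : ℝ) / 2 < s) (hω : 0 < ω) {σ : ℝ}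
    (hσ : 0 < σ) :
    ‖valueAtZero (standingWave n s ω σ)‖ ^ (2 * σ) = (greenIntegral n s ω)⁻¹ := by
  have hK := greenIntegral_pos (n := n) hs hω
  have hgi : Integrable (𝓕 (green n s ω) : L2 n) volume :=
    (integrable_greenSymbol hs hω).ofReal.congr (fourier_green hs hω).symm
  obtain ⟨hrep, hval⟩ := hasContinuousRep_of_integrable hgi
  have hdef : standingWave n s ω σ =
      (((greenIntegral n s ω) ^ (-(1 + 1 / (2 * σ))) : ℝ) : ℂ) • green n s ω := rfl
  -- With `I = I(ω)`, the exponents combine as `(I^{-(1 + 1/(2σ))} · I)^{2σ} = I^{-1}`.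
  rw [hdef, (hrep.smul _).2, hval, integral_fourier_green hs hω, ← Complex.ofReal_mul,
    Complex.norm_of_nonneg (by positivity), ← Real.rpow_add_one hK.ne', ← Real.rpow_mul hK.le,
    ← Real.rpow_neg_one]
  congr 1
  field_simp
  ring

end Sobolev

end

end DeltaSchrodinger

/-! ### The main theorem: location of `t₀` relative to `ω`. -/

theorem mainTheorem7 (n : ℕ) (hn : 1 ≤ n) (s ω : ℝ) (hs : (n : ℝ) / 2 < s) (hω : 0 < ω) :
    (∀ μ : ℝ, 0 < μ →
      IsSelfAdjoint (DeltaSchrodinger.deltaOp n s ω μ) ∧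
      (DeltaSchrodinger.cSq n s ω < μ →
        ∃ lam : ℝ, 0 < lam ∧
          DeltaSchrodinger.IsSimpleEigenvalue (DeltaSchrodinger.deltaOp n s ω μ)
            ((-lam : ℝ) : ℂ) (DeltaSchrodinger.green n s (ω + lam)) ∧
          (∀ t : ℝ, t < 0 →
            DeltaSchrodinger.eigenspace (DeltaSchrodinger.deltaOp n s ω μ) (t : ℂ) ≠ ⊥ →
              t = -lam) ∧
          DeltaSchrodinger.spec (DeltaSchrodinger.deltaOp n s ω μ) \ {((-lam : ℝ) : ℂ)} ⊆
            DeltaSchrodinger.halfLine ω ∧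
          DeltaSchrodinger.BoundedBelowOnPerp (DeltaSchrodinger.deltaOp n s ω μ)
            (DeltaSchrodinger.green n s (ω + lam)) ω) ∧
      (μ = DeltaSchrodinger.cSq n s ω →
          DeltaSchrodinger.IsNonneg (DeltaSchrodinger.deltaOp n s ω μ) ∧
          DeltaSchrodinger.IsSimpleEigenvalue (DeltaSchrodinger.deltaOp n s ω μ) 0
            (DeltaSchrodinger.green n s ω) ∧
          DeltaSchrodinger.spec (DeltaSchrodinger.deltaOp n s ω μ) \ {0} ⊆
            DeltaSchrodinger.halfLine ω ∧
          DeltaSchrodinger.BoundedBelowOnPerp (DeltaSchrodinger.deltaOp n s ω μ)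
            (DeltaSchrodinger.green n s ω) ω) ∧
      (μ < DeltaSchrodinger.cSq n s ω →
        ∃ lam : ℝ, 0 < lam ∧ lam < ω ∧
          DeltaSchrodinger.IsSimpleEigenvalue (DeltaSchrodinger.deltaOp n s ω μ)
            (lam : ℂ) (DeltaSchrodinger.green n s (ω - lam)) ∧
          DeltaSchrodinger.spec (DeltaSchrodinger.deltaOp n s ω μ) \ {(lam : ℂ)} ⊆
            DeltaSchrodinger.halfLine ω ∧
          DeltaSchrodinger.BoundedBelowOnPerp (DeltaSchrodinger.deltaOp n s ω μ)
            (DeltaSchrodinger.green n s (ω - lam)) ω)) ∧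
    (∀ σ : ℝ, 0 < σ →
      (IsSelfAdjoint (DeltaSchrodinger.Lminus n s ω σ) ∧
        DeltaSchrodinger.IsNonneg (DeltaSchrodinger.Lminus n s ω σ) ∧
        DeltaSchrodinger.IsSimpleEigenvalue (DeltaSchrodinger.Lminus n s ω σ) 0
          (DeltaSchrodinger.green n s ω) ∧
        DeltaSchrodinger.spec (DeltaSchrodinger.Lminus n s ω σ) \ {0} ⊆
          DeltaSchrodinger.halfLine ω ∧
        DeltaSchrodinger.BoundedBelowOnPerp (DeltaSchrodinger.Lminus n s ω σ)
          (DeltaSchrodinger.green n s ω) ω) ∧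
      (IsSelfAdjoint (DeltaSchrodinger.Lplus n s ω σ) ∧
        DeltaSchrodinger.eigenspace (DeltaSchrodinger.Lplus n s ω σ) 0 = ⊥ ∧
        ∃ lam : ℝ, 0 < lam ∧
          DeltaSchrodinger.IsSimpleEigenvalue (DeltaSchrodinger.Lplus n s ω σ)
            ((-lam : ℝ) : ℂ) (DeltaSchrodinger.green n s (ω + lam)) ∧
          (∀ t : ℝ, t < 0 →
            DeltaSchrodinger.eigenspace (DeltaSchrodinger.Lplus n s ω σ) (t : ℂ) ≠ ⊥ →
              t = -lam) ∧
          DeltaSchrodinger.spec (DeltaSchrodinger.Lplus n s ω σ) \ {((-lam : ℝ) : ℂ)} ⊆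
            DeltaSchrodinger.halfLine ω ∧
          DeltaSchrodinger.BoundedBelowOnPerp (DeltaSchrodinger.Lplus n s ω σ)
            (DeltaSchrodinger.green n s (ω + lam)) ω)) := by
  have hK := DeltaSchrodinger.greenIntegral_pos (n := n) hs hω
  have hc := DeltaSchrodinger.cSq_eq hs hω
  have hanti := DeltaSchrodinger.greenIntegral_strictAntiOn (n := n) hs
  -- This is the `t₀` of the spectral lemmas. As `cSq = I(ω)⁻¹`, `μ = I(t₀)⁻¹` and `I` decreases,
  -- `μ` lies above or below `cSq` according as `t₀` lies above or below `ω`.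
  have key : ∀ μ : ℝ, 0 < μ →
      ∃ t, 0 < t ∧ μ * DeltaSchrodinger.greenIntegral n s t = 1 := by
    intro μ hμ
    obtain ⟨t, ht, h⟩ := DeltaSchrodinger.exists_greenIntegral_eq (n := n) hs (inv_pos.2 hμ)
    exact ⟨t, ht, by rw [h, mul_inv_cancel₀ hμ.ne']⟩
  have habove : ∀ μ t : ℝ, 0 < t → μ * DeltaSchrodinger.greenIntegral n s t = 1 →
      DeltaSchrodinger.cSq n s ω < μ → ω < t := by
    intro μ t ht h hlt
    have hI := DeltaSchrodinger.greenIntegral_pos (n := n) hs ht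
    rw [hc, eq_inv_of_mul_eq_one_left h, inv_lt_inv₀ hK hI] at hlt
    exact (hanti.lt_iff_gt ht hω).1 hlt
  have hbelow : ∀ μ t : ℝ, 0 < t → μ * DeltaSchrodinger.greenIntegral n s t = 1 →
      μ < DeltaSchrodinger.cSq n s ω → t < ω := by
    intro μ t ht h hlt
    have hI := DeltaSchrodinger.greenIntegral_pos (n := n) hs ht
    rw [hc, eq_inv_of_mul_eq_one_left h, inv_lt_inv₀ hI hK] at hlt
    exact (hanti.lt_iff_gt hω ht).1 hlt
  have hsa : ∀ μ : ℝ, 0 < μ → IsSelfAdjoint (DeltaSchrodinger.deltaOp n s ω μ) := by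
    intro μ hμ
    obtain ⟨t, ht, h⟩ := key μ hμ
    exact DeltaSchrodinger.isSelfAdjoint_deltaOp hs hω ht h
  have hsup : ∀ μ : ℝ, 0 < μ → DeltaSchrodinger.cSq n s ω < μ →
      DeltaSchrodinger.eigenspace (DeltaSchrodinger.deltaOp n s ω μ) 0 = ⊥ ∧
        ∃ lam : ℝ, 0 < lam ∧
          DeltaSchrodinger.IsSimpleEigenvalue (DeltaSchrodinger.deltaOp n s ω μ)
            ((-lam : ℝ) : ℂ) (DeltaSchrodinger.green n s (ω + lam)) ∧
          (∀ t : ℝ, t < 0 →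
            DeltaSchrodinger.eigenspace (DeltaSchrodinger.deltaOp n s ω μ) (t : ℂ) ≠ ⊥ →
              t = -lam) ∧
          DeltaSchrodinger.spec (DeltaSchrodinger.deltaOp n s ω μ) \ {((-lam : ℝ) : ℂ)} ⊆
            DeltaSchrodinger.halfLine ω ∧
          DeltaSchrodinger.BoundedBelowOnPerp (DeltaSchrodinger.deltaOp n s ω μ)
            (DeltaSchrodinger.green n s (ω + lam)) ω := by
    intro μ hμ hlt
    obtain ⟨t, ht, h⟩ := key μ hμ
    have hωt := habove μ t ht h hlt
    have e1 : -(t - ω) = ω - t := neg_sub _ _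
    refine ⟨?_, t - ω, sub_pos.2 hωt, ?_⟩
    · have := DeltaSchrodinger.eigenspace_deltaOp_eq_bot hs hω ht h hω (by linarith : 0 ≠ ω - t)
      rwa [Complex.ofReal_zero] at this
    · rw [e1, add_sub_cancel]
      refine ⟨DeltaSchrodinger.isSimpleEigenvalue_deltaOp hs hω ht h, fun x hx hne => ?_,
        DeltaSchrodinger.spec_deltaOp_subset hs hω ht h,
        DeltaSchrodinger.boundedBelowOnPerp_deltaOp hs hω hμ ht h⟩
      by_contra hcon
      exact hne (DeltaSchrodinger.eigenspace_deltaOp_eq_bot hs hω ht h (hx.trans hω) hcon)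
  have hcrit : ∀ μ : ℝ, 0 < μ → μ = DeltaSchrodinger.cSq n s ω →
      DeltaSchrodinger.IsNonneg (DeltaSchrodinger.deltaOp n s ω μ) ∧
      DeltaSchrodinger.IsSimpleEigenvalue (DeltaSchrodinger.deltaOp n s ω μ) 0
        (DeltaSchrodinger.green n s ω) ∧
      DeltaSchrodinger.spec (DeltaSchrodinger.deltaOp n s ω μ) \ {0} ⊆
        DeltaSchrodinger.halfLine ω ∧
      DeltaSchrodinger.BoundedBelowOnPerp (DeltaSchrodinger.deltaOp n s ω μ)
        (DeltaSchrodinger.green n s ω) ω := by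
    intro μ hμ heq
    have h : μ * DeltaSchrodinger.greenIntegral n s ω = 1 := by
      rw [heq, hc, inv_mul_cancel₀ hK.ne']
    have h1 := DeltaSchrodinger.isSimpleEigenvalue_deltaOp hs hω hω h
    have h2 := DeltaSchrodinger.spec_deltaOp_subset hs hω hω h
    rw [sub_self, Complex.ofReal_zero] at h1 h2
    exact ⟨DeltaSchrodinger.isNonneg_deltaOp hs hω hμ h, h1, h2,
      DeltaSchrodinger.boundedBelowOnPerp_deltaOp hs hω hμ hω h⟩
  refine ⟨fun μ hμ => ⟨hsa μ hμ, fun hlt => (hsup μ hμ hlt).2, hcrit μ hμ, fun hlt => ?_⟩,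
    fun σ hσ => ?_⟩
  · obtain ⟨t, ht, h⟩ := key μ hμ
    have htω := hbelow μ t ht h hlt
    refine ⟨ω - t, sub_pos.2 htω, sub_lt_self _ ht, ?_⟩
    rw [sub_sub_cancel]
    exact ⟨DeltaSchrodinger.isSimpleEigenvalue_deltaOp hs hω ht h,
      DeltaSchrodinger.spec_deltaOp_subset hs hω ht h,
      DeltaSchrodinger.boundedBelowOnPerp_deltaOp hs hω hμ ht h⟩
  · have hφ := DeltaSchrodinger.norm_valueAtZero_standingWave_rpow (n := n) hs hω hσ
    have hKi := inv_pos.2 hK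
    rw [DeltaSchrodinger.Lminus, DeltaSchrodinger.Lplus, hφ]
    have hμ : 0 < (2 * σ + 1) * (DeltaSchrodinger.greenIntegral n s ω)⁻¹ := by positivity
    -- `Lminus` has `μ = cSq`. For `Lplus` the remaining claim is `cSq < (2σ + 1) cSq`.
    refine ⟨⟨hsa _ hKi, hcrit _ hKi hc.symm⟩, hsa _ hμ, hsup _ hμ ?_⟩
    rw [hc]
    nlinarith
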